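/- **Setting.** There are $N\ge 1$ players. Player $i$ has a compact convex strategy set $X_i\subset\mathbb R^{n_i}$ and the payoff $f_i(x)=\mathbb E[\psi_i(x;\xi)]$, where $\xi$ is a random vector in $\mathbb R^d$. Put $X=\prod_i X_i$. Assume: * for every $x_{-i}\in X_{-i}$, $f_i(\cdot,x_{-i})$ is well defined, convex and $C^2$ over an open set containing $X_i$; the mixed second derivatives $\nabla^2_{x_ix_j}f_i$ $(j\ne i)$ exist and are bounded on $X$; * $\psi_i(\cdot,x_{-i};\xi)$ is almost surely differentiable over an open set containing $X_i$, $\nabla_{x_i}\psi_i$ is measurable, $\nabla_{x_i}f_i(x)=\mathbb E[\nabla_{x_i}\psi_i(x;\xi)]$ and $\mathbb E\|\nabla_{x_i}\psi_i(x;\xi)\|^2\le M_i^2$ with $M_i>0$, for all $x\in X$. With $\zeta_{i,\min}=\inf_{x\in X}\lambda_{\min}(\nabla^2_{x_i}f_i(x))$ and $\zeta_{ij,\max}=\sup_{x\in X}\|\nabla^2_{x_ix_j}f_i(x)\|$ assume strict diagonal dominance $\zeta_{i,\min}>\sum_{j\ne i}\zeta_{ij,\max}$ for all $i$. For $\mu>0$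 let $\Gamma$ be the $N\times N$ matrix with $\Gamma_{ii}=\mu/(\mu+\zeta_{i,\min})$ and $\Gamma_{ij}=\zeta_{ij,\max}/(\mu+\zeta_{i,\min})$ for $j\neq i$, and let $a_\infty=\|\Gamma\|_\infty$. Let $\hat x_i(y)=\operatorname{argmin}_{u\in X_i}\{f_i(u,y_{-i})+\frac\mu2\|u-y_i\|^2\}$, let $x^*$ be a Nash equilibrium, and let $Q_i=2M_i^2/\mu^2+2\operatorname{diam}(X_i)^2$. A random profile $x$ is an $\epsilon$-NE$_\infty$ if $\max_i\mathbb E\|x_i-x_i^*\|\le\epsilon$. **Algorithm.** Let $I_0,I_1,\dots\subset\{1,\dots,N\}$ be deterministic sets and let $x_0$ be a random point of $X$. At time $k$ every player $i\in I_k$ uses $y_k^i=(x_{j,k-\tau_{ij}(k)})_j$ with random delays $\tau_{ij}(k)\le k$, $\tau_{ii}(k)=0$ and $\tau_{ij}(k)\le B_2$ almost surely, and computes $$z_{i,1}=x_{i,k},\qquad z_{i,t+1}=\Pi_{X_i}\Big[z_{i,t}-\tfrac1{\mu(t+1)}\big(\nabla_{x_i}\psi_i(z_{i,t},y^i_{-i,k};\xi^t_{i,k})+\mu(z_{i,t}-x_{i,k})\big)\Big],\qquad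 x_{i,k+1}=z_{i,j_{i,k}},$$ at the cost of $j_{i,k}$ projected gradient steps; players $i\notin I_k$ keep $x_{i,k+1}=x_{i,k}$. Let $\mathcal F_k$ be generated by $x_0$, the delays used up to and including time $k$, and the samples used before time $k$. Conditionally on $\mathcal F_k$ and $\xi_{i,k}^1,\dots,\xi_{i,k}^{t-1}$, the sampled gradients used in the $t$-th step are square integrable and unbiased, with second moment at most $M_i^2$. Let $\beta_{i,k}$ be the number of updates of player $i$ up to and including time $k$. **Theorem.** Set $\eta=a_\infty$; then $\eta\in(0,1)$. Below $C\ge0$, $\epsilon>0$, $\delta>0$, and $\lceil\cdot\rceil$ of a negative number is read as $0$. **(a)** Suppose every player updates at least once in any time interval of length $B_1\ge1$. Let $n_0=\lceil B_2/B_1\rceil$, $n'=B_1(1+n_0)$, $\rho=\eta^{1/(n_0+1)}$, $c=\rho^{1/B_1}$, $D=\dfrac{n'+2(n')^2\delta^{-1}}{e\ln(\eta^{-1})}$ and $\hat\epsilon=\dfrac{\epsilon}{C+D}\,\eta^{\frac{B_1-1}{B_1(n_0+1)}}$. There is $q\in(c,1)$, not depending on $C$ and $\epsilon$, with $D=1/\ln((q/c)^e)$,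 such that $$\ell_i^{(1)}(\eta):=\frac{Q_i}{\eta^4\ln(1/\eta^2)}\Big(\frac1{\hat\epsilon}\Big)^{\frac{\ln(1/\eta^2)}{\ln(1/q)}}+\Big\lceil\frac{\ln(1/\hat\epsilon)}{\ln(1/q)}\Big\rceil\le\frac{Q_i}{\eta^4\ln(1/\eta^2)}\Big(\frac1{\hat\epsilon}\Big)^{2n'+\delta}+\Big\lceil\ln\Big(\frac1{\hat\epsilon}\Big)\frac{2n'+\delta}{2\ln(\eta^{-1})}\Big\rceil ,$$ so $\ell_i^{(1)}(\eta)=O\big((1/\epsilon)^{2B_1(1+\lceil B_2/B_1\rceil)+\delta}\big)$ as $\epsilon\to0$. If $B_1=1$, then $D=\frac{(1+B_2)+2(1+B_2)^2\delta^{-1}}{e\ln(\eta^{-1})}$ and $$\ell_i^{(1)}(\eta)\le\frac{Q_i}{\eta^4\ln(1/\eta^2)}\Big(\frac{C+D}\epsilon\Big)^{2(1+B_2)+\delta}+\Big\lceil\ln\Big(\frac{C+D}\epsilon\Big)\frac{2(B_2+1)+\delta}{2\ln(\eta^{-1})}\Big\rceil .$$ If moreover $B_2=0$, then $D=\frac{1+2\delta^{-1}}{e\ln(\eta^{-1})}$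 and the exponent is $2+\delta$. Take $j_{i,k}=\lceil Q_i\eta^{-2(k+1)}\rceil$. Then: 1. $\mathbb E[\|x_{i,k+1}-\hat x_i(y_k^i)\|^2\mid\mathcal F_k]\le\eta^{2\beta_{i,k}}$ almost surely for $i\in I_k$. 2. The number of projected gradient steps of each player $i$ up to major iteration $K=\lceil\ln(1/\hat\epsilon)/\ln(1/q)\rceil$ is at most $\ell^{(1)}_i(\eta)$; and $x_K$ is an $\epsilon$-NE$_\infty$ whenever $\mathbb E\|x_{i,0}-x_i^*\|\le C$ for all $i$ and each delay $\tau_{ij}(k)$, $i\in I_k$, is independent of $(x_0,\dots,x_k)$. 3. For arbitrary random delays as above, there is a constant $A$, not depending on $\epsilon$ or on the run of the algorithm, such that for every $\epsilon\in(0,1]$ there is $K$ for which $x_K$ is an $\epsilon$-NE$_\infty$ in every run, each player taking at most $A(1/\epsilon)^{2B_1(1+\lceil B_2/B_1\rceil)+\delta}$ projected gradient steps up to iteration $K$. **(b)** Suppose exactly one player updates at each time, in a fixed cyclic order. Let $n_0=\lceil B_2/N\rceil$, $\rho=\eta^{1/(n_0+1)}$, $c=\rho^{1/N}$, $D=N(1+n_0)\dfrac{1+2(1+n_0)\delta^{-1}}{e\ln(\eta^{-1})}$,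 $\tilde\epsilon=\dfrac{\epsilon}{C+D}\,\eta^{\frac{N-1}{N(1+n_0)}}$ and $\tilde\eta=\eta^{1/N}$. There is $q\in(c,1)$, not depending on $C$ and $\epsilon$, with $D=1/\ln((q/c)^e)$, such that $$\ell_i^{(2)}(\eta):=\frac{Q_i}{\tilde\eta^2\eta^2\ln(1/\tilde\eta^2)}\Big(\frac1{\tilde\epsilon}\Big)^{\frac{\ln(1/\tilde\eta^2)}{\ln(1/q)}}+\Big\lceil\frac{\ln(1/\tilde\epsilon)}{\ln(1/q)}\Big\rceil\le\frac{Q_i}{\eta^{2+2/N}\ln(1/\eta^{2/N})}\Big(\frac1{\tilde\epsilon}\Big)^{2(n_0+1)+\delta}+\Big\lceil\ln\Big(\frac1{\tilde\epsilon}\Big)\frac{2(n_0+1)+\delta}{2\ln(\eta^{-1})/N}\Big\rceil ,$$ so $\ell_i^{(2)}(\eta)=O\big((1/\epsilon)^{2(1+\lceil B_2/N\rceil)+\delta}\big)$ as $\epsilon\to0$. If $B_2=0$, then $D=\frac{N(1+2\delta^{-1})}{e\ln(\eta^{-1})}$, $\tilde\epsilon=\frac\epsilon{C+D}\rho^{(N-1)/N}$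 and the bound holds with $n_0=0$, i.e. with exponent $2+\delta$. With $j_{i,k}=\lceil Q_i\eta^{-(2+2k/N)}\rceil$, assertions 1–3 of (a) hold with $\ell_i^{(2)}$, $\tilde\epsilon$ and the exponent $2(1+\lceil B_2/N\rceil)+\delta$ in place of $\ell_i^{(1)}$, $\hat\epsilon$ and the exponent there. -/

import Mathlib

open MeasureTheory ProbabilityTheory Filter Topology Asymptotics

noncomputable section

namespace AsyncBR

/-! ### The stochastic Nash game -/

/-- Strategy space of player `i`: Euclidean space of dimension `n i`. -/
abbrev Strat {N : ℕ} (n : Fin N → ℕ) (i : Fin N) : Type := EuclideanSpace ℝ (Fin (n i))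

/-- Strategy profiles. -/
abbrev Profile {N : ℕ} (n : Fin N → ℕ) : Type := ∀ i, Strat n i

/-- Values of the random vector `ξ`. -/
abbrev Noise (d : ℕ) : Type := EuclideanSpace ℝ (Fin d)

/-- Partial gradient `∇_{x_i} g (x)`. -/
def partialGrad {N : ℕ} {n : Fin N → ℕ} (g : Profile n → ℝ) (i : Fin N) (x : Profile n) :
    Strat n i :=
  gradient (fun u : Strat n i => g (Function.update x i u)) (x i)

/-- Data of an `N`-player stochastic Nash game: strategy sets, sampled payoffs, and the
distribution of the random vector `ξ`. -/
structure StochGame {N : ℕ} (n : Fin N → ℕ) (d : ℕ) where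
  /-- strategy sets -/
  X : ∀ i, Set (Strat n i)
  /-- sampled payoffs `ψ_i(x; s)` -/
  ψ : Fin N → Profile n → Noise d → ℝ
  /-- distribution of `ξ` -/
  law : Measure (Noise d)

/-- Smallest eigenvalue of the symmetric part `(A + Aᵀ) / 2`. -/
def lambdaMin {m : ℕ}
    (A : EuclideanSpace ℝ (Fin m) →L[ℝ] EuclideanSpace ℝ (Fin m)) : ℝ :=
  sInf {l : ℝ | Module.End.HasEigenvalue
    ((((1 / 2 : ℝ) • (A + ContinuousLinearMap.adjoint A) :
      EuclideanSpace ℝ (Fin m) →L[ℝ] EuclideanSpace ℝ (Fin m)) :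
      EuclideanSpace ℝ (Fin m) →ₗ[ℝ] EuclideanSpace ℝ (Fin m))) l}

/-- Euclidean projection on `S` (a nearest point of `S`; unique when `S` is nonempty, closed
and convex). -/
def proj {m : ℕ} (S : Set (EuclideanSpace ℝ (Fin m))) (u : EuclideanSpace ℝ (Fin m)) :
    EuclideanSpace ℝ (Fin m) :=
  Classical.epsilon fun v => v ∈ S ∧ ∀ w ∈ S, ‖u - v‖ ≤ ‖u - w‖

namespace StochGame

variable {N : ℕ} {n : Fin N → ℕ} {d : ℕ} (G : StochGame n d)

/-- The joint strategy set `X = ∏ X_i`. -/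
def joint : Set (Profile n) := {x | ∀ i, x i ∈ G.X i}

/-- Expected payoff `f_i(x) = 𝔼[ψ_i(x; ξ)]`. -/
def f (i : Fin N) (x : Profile n) : ℝ := ∫ s, G.ψ i x s ∂G.law

/-- Sampled gradient `∇_{x_i} ψ_i(x; s)`. -/
def gradψ (i : Fin N) (x : Profile n) (s : Noise d) : Strat n i :=
  partialGrad (fun y => G.ψ i y s) i x

/-- Gradient `∇_{x_i} f_i(x)`. -/
def gradf (i : Fin N) (x : Profile n) : Strat n i := partialGrad (G.f i) i x

/-- Second-derivative block `∇²_{x_i x_j} f_i(x)` (and `∇²_{x_i} f_i(x)` for `j = i`). -/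
def hess (i j : Fin N) (x : Profile n) : Strat n j →L[ℝ] Strat n i :=
  fderiv ℝ (fun u : Strat n j => G.gradf i (Function.update x j u)) (x j)

/-- `ζ_{i,min} = inf_{x ∈ X} λ_min(∇²_{x_i} f_i(x))`. -/
def zetaMin (i : Fin N) : ℝ := ⨅ x : G.joint, lambdaMin (G.hess i i x)

/-- `ζ_{ij,max} = sup_{x ∈ X} ‖∇²_{x_i x_j} f_i(x)‖`. -/
def zetaMax (i j : Fin N) : ℝ := ⨆ x : G.joint, ‖G.hess i j x‖

/-- The matrix `Γ`. -/
def Gam (μ : ℝ) : Matrix (Fin N) (Fin N) ℝ := fun i j =>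
  if j = i then μ / (μ + G.zetaMin i) else G.zetaMax i j / (μ + G.zetaMin i)

/-- `a_∞ = ‖Γ‖_∞`, the operator norm induced by the sup norm. -/
def aInf (μ : ℝ) : ℝ :=
  letI : NormedAddCommGroup (Matrix (Fin N) (Fin N) ℝ) := Matrix.linftyOpNormedAddCommGroup
  ‖G.Gam μ‖

/-- `x` is a Nash equilibrium. -/
def IsNash (x : Profile n) : Prop :=
  x ∈ G.joint ∧ ∀ i, ∀ u ∈ G.X i, G.f i x ≤ G.f i (Function.update x i u)

/-- Standing assumptions on the game; `M i` bounds the second moment of the sampled gradient. -/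
structure Regular (M : Fin N → ℝ) : Prop where
  prob : IsProbabilityMeasure G.law
  compact : ∀ i, IsCompact (G.X i)
  convex : ∀ i, Convex ℝ (G.X i)
  /-- `f_i` is well defined, convex and `C²` in `x_i` over an open set containing `X_i`. -/
  payoff : ∀ i, ∀ x ∈ G.joint, ∃ U : Set (Strat n i), IsOpen U ∧ G.X i ⊆ U ∧
    (∀ u ∈ U, Integrable (G.ψ i (Function.update x i u)) G.law) ∧
    ConvexOn ℝ U (fun u => G.f i (Function.update x i u)) ∧
    ContDiffOn ℝ 2 (fun u => G.f i (Function.update x i u)) U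
  /-- The mixed second derivatives entering `ζ_{ij,max}` exist on `X`, and `ζ_{ij,max} < ∞`. -/
  mixed : ∀ i j, i ≠ j →
    (∀ x ∈ G.joint, DifferentiableAt ℝ
      (fun u : Strat n j => G.gradf i (Function.update x j u)) (x j)) ∧
    BddAbove (Set.range fun x : G.joint => ‖G.hess i j x‖)
  sample_diff : ∀ i, ∀ x ∈ G.joint, ∀ᵐ s ∂G.law, ∃ U : Set (Strat n i),
    IsOpen U ∧ G.X i ⊆ U ∧ DifferentiableOn ℝ (fun u => G.ψ i (Function.update x i u) s) U
  sample_meas : ∀ i, Measurable fun p : G.joint × Noise d => G.gradψ i p.1 p.2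
  sample_mean : ∀ i, ∀ x ∈ G.joint, Integrable (G.gradψ i x) G.law ∧
    G.gradf i x = ∫ s, G.gradψ i x s ∂G.law
  bound_pos : ∀ i, 0 < M i
  sample_bound : ∀ i, ∀ x ∈ G.joint, Integrable (fun s => ‖G.gradψ i x s‖ ^ 2) G.law ∧
    ∫ s, ‖G.gradψ i x s‖ ^ 2 ∂G.law ≤ M i ^ 2

/-- Strict diagonal dominance. -/
def DiagDominant : Prop :=
  ∀ i, ∑ j ∈ Finset.univ.erase i, G.zetaMax i j < G.zetaMin i

/-- The proximal best response `x̂_i(y) = argmin_{u ∈ X_i} f_i(u, y_{-i}) + (μ/2) ‖u - y_i‖²`. -/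
def proxBR (μ : ℝ) (i : Fin N) (y : Profile n) : Strat n i :=
  Classical.epsilon fun u => u ∈ G.X i ∧
    IsMinOn (fun v => G.f i (Function.update y i v) + μ / 2 * ‖v - y i‖ ^ 2) (G.X i) u

/-- `Q_i = 2 M_i² / μ² + 2 D_{X_i}²`, with `D_{X_i}` the diameter of `X_i`. -/
def Q (μ : ℝ) (M : Fin N → ℝ) (i : Fin N) : ℝ :=
  2 * M i ^ 2 / μ ^ 2 + 2 * Metric.diam (G.X i) ^ 2

/-! ### The asynchronous inexact proximal best-response scheme -/

/-- Projected stochastic gradient iterates `z_{i,t}`, `t ≥ 1`, for player `i` with current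
strategy `x₀ = z_{i,1}`, available profile `y`, samples `s 1, s 2, …` and step sizes
`γ_t = 1 / (μ (t + 1))`. The index `0` is not used. -/
def sa (μ : ℝ) (i : Fin N) (y : Profile n) (x₀ : Strat n i) (s : ℕ → Noise d) : ℕ → Strat n i
  | 0 => x₀
  | 1 => x₀
  | t + 2 =>
    proj (G.X i) (sa μ i y x₀ s (t + 1) - (1 / (μ * (((t + 1 : ℕ) : ℝ) + 1))) •
      (G.gradψ i (Function.update y i (sa μ i y x₀ s (t + 1))) (s (t + 1)) +
        μ • (sa μ i y x₀ s (t + 1) - x₀)))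

end StochGame

section Protocol

variable {N : ℕ} {n : Fin N → ℕ} {d : ℕ} {Ω : Type*}

/-- Every player updates at least once in any time interval of length `B₁`;
`I k` is the (deterministic) set of players that update at time `k`. -/
def UpdatesWithin (I : ℕ → Finset (Fin N)) (B₁ : ℕ) : Prop :=
  ∀ i k, ∃ l, k ≤ l ∧ l < k + B₁ ∧ i ∈ I l

/-- One player updates at each time, in a fixed cyclic order. -/
def UpdatesCyclically [NeZero N] (I : ℕ → Finset (Fin N)) : Prop :=
  ∃ σ : Equiv.Perm (Fin N), ∀ k, I k = {σ (Fin.ofNat N k)}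

/-- `β_{i,k}`: the number of updates of player `i` up to and including time `k`. -/
def updateCount (I : ℕ → Finset (Fin N)) (i : Fin N) (k : ℕ) : ℕ :=
  ((Finset.range (k + 1)).filter fun l => i ∈ I l).card

/-- Number of projected gradient steps taken by player `i` to produce `x_K`, when an update of
player `i` at time `k` uses `J i k` steps. -/
def totalSteps (I : ℕ → Finset (Fin N)) (J : Fin N → ℕ → ℕ) (i : Fin N) (K : ℕ) : ℕ :=
  ∑ k ∈ (Finset.range K).filter (fun k => i ∈ I k), J i k

/-- The outdated profile `y_k^i = (x_{1, k - τ_{i1}(k)}, …, x_{N, k - τ_{iN}(k)})`. -/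
def delayed (x : ℕ → Ω → Profile n) (τ : Fin N → Fin N → ℕ → Ω → ℕ) (i : Fin N) (k : ℕ)
    (ω : Ω) : Profile n :=
  fun j => x (k - τ i j k ω) ω j

/-- `𝓕'_k`, generated by `x_0` and by the delays and samples used at times `l < k`. -/
abbrev pastField (I : ℕ → Finset (Fin N)) (J : Fin N → ℕ → ℕ) (x : ℕ → Ω → Profile n)
    (τ : Fin N → Fin N → ℕ → Ω → ℕ) (ξ : Fin N → ℕ → ℕ → Ω → Noise d) (k : ℕ) :
    MeasurableSpace Ω :=
  MeasurableSpace.comap (x 0) inferInstance ⊔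
    ⨆ l : ℕ, ⨆ _ : l < k, ⨆ i : Fin N, ⨆ _ : i ∈ I l,
      ((⨆ j : Fin N, MeasurableSpace.comap (τ i j l) inferInstance) ⊔
        ⨆ t : ℕ, ⨆ _ : 1 ≤ t ∧ t ≤ J i l, MeasurableSpace.comap (ξ i l t) inferInstance)

/-- `𝓕_k`, generated by `𝓕'_k` and by the delays at time `k`. -/
abbrev curField (I : ℕ → Finset (Fin N)) (J : Fin N → ℕ → ℕ) (x : ℕ → Ω → Profile n)
    (τ : Fin N → Fin N → ℕ → Ω → ℕ) (ξ : Fin N → ℕ → ℕ → Ω → Noise d) (k : ℕ) :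
    MeasurableSpace Ω :=
  pastField I J x τ ξ k ⊔
    ⨆ i : Fin N, ⨆ _ : i ∈ I k, ⨆ j : Fin N, MeasurableSpace.comap (τ i j k) inferInstance

/-- The σ-field generated by `𝓕_k` and `ξ_{i,k}^1, …, ξ_{i,k}^{t-1}`. -/
abbrev innerField (I : ℕ → Finset (Fin N)) (J : Fin N → ℕ → ℕ) (x : ℕ → Ω → Profile n)
    (τ : Fin N → Fin N → ℕ → Ω → ℕ) (ξ : Fin N → ℕ → ℕ → Ω → Noise d) (i : Fin N) (k t : ℕ) :
    MeasurableSpace Ω :=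
  curField I J x τ ξ k ⊔
    ⨆ s : ℕ, ⨆ _ : 1 ≤ s ∧ s < t, MeasurableSpace.comap (ξ i k s) inferInstance

/-- The SA iterate `z_{i,t}` inside the update of player `i` at time `k`. -/
def inner (G : StochGame n d) (μ : ℝ) (x : ℕ → Ω → Profile n)
    (τ : Fin N → Fin N → ℕ → Ω → ℕ) (ξ : Fin N → ℕ → ℕ → Ω → Noise d) (i : Fin N) (k t : ℕ)
    (ω : Ω) : Strat n i :=
  G.sa μ i (delayed x τ i k ω) (x k ω i) (fun s => ξ i k s ω) t

/-- `(x, τ, ξ)` (iterates, delays, samples) is a run of the asynchronous scheme in which player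
`i`, when updating at time `k`, makes `J i k` projected stochastic gradient steps. Delays are
random and bounded by `B₂`; conditionally on the past the sampled gradients are unbiased, with
second moment at most `M i ^ 2`. -/
structure IsAsyncRun [MeasurableSpace Ω] (G : StochGame n d) (μ : ℝ) (M : Fin N → ℝ)
    (I : ℕ → Finset (Fin N)) (B₂ : ℕ) (J : Fin N → ℕ → ℕ) (P : Measure Ω)
    (x : ℕ → Ω → Profile n) (τ : Fin N → Fin N → ℕ → Ω → ℕ)
    (ξ : Fin N → ℕ → ℕ → Ω → Noise d) : Prop where
  init_meas : Measurable (x 0)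
  delay_meas : ∀ i j k, Measurable (τ i j k)
  sample_meas : ∀ i k t, Measurable (ξ i k t)
  init_mem : ∀ ω, x 0 ω ∈ G.joint
  delay_le : ∀ i j k ω, τ i j k ω ≤ k
  delay_self : ∀ i k ω, τ i i k ω = 0
  delay_bdd : ∀ k, ∀ i ∈ I k, ∀ j, ∀ᵐ ω ∂P, τ i j k ω ≤ B₂
  update : ∀ k, ∀ i ∈ I k, ∀ ω, x (k + 1) ω i = inner G μ x τ ξ i k (J i k) ω
  stay : ∀ k, ∀ i ∉ I k, ∀ ω, x (k + 1) ω i = x k ω i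
  sample_sq : ∀ k, ∀ i ∈ I k, ∀ t, 1 ≤ t → t ≤ J i k → MemLp (fun ω => G.gradψ i
    (Function.update (delayed x τ i k ω) i (inner G μ x τ ξ i k t ω)) (ξ i k t ω)) 2 P
  sample_unbiased : ∀ k, ∀ i ∈ I k, ∀ t, 1 ≤ t → t ≤ J i k →
    P[fun ω => G.gradψ i (Function.update (delayed x τ i k ω) i (inner G μ x τ ξ i k t ω))
        (ξ i k t ω) | innerField I J x τ ξ i k t] =ᵐ[P]
      fun ω => G.gradf i (Function.update (delayed x τ i k ω) i (inner G μ x τ ξ i k t ω))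
  sample_bound : ∀ k, ∀ i ∈ I k, ∀ t, 1 ≤ t → t ≤ J i k →
    P[fun ω => ‖G.gradψ i (Function.update (delayed x τ i k ω) i (inner G μ x τ ξ i k t ω))
        (ξ i k t ω)‖ ^ 2 | innerField I J x τ ξ i k t] ≤ᵐ[P] fun _ => M i ^ 2

/-- The inexactness criterion of the scheme: whenever `i ∈ I k`, `x_{i,k+1} ∈ X_i` and
`𝔼[‖x_{i,k+1} - x̂_i(y_k^i)‖² | 𝓕_k] ≤ α_{i,k}²` almost surely. -/
def IsInexactBR [MeasurableSpace Ω] (G : StochGame n d) (μ : ℝ)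
    (I : ℕ → Finset (Fin N)) (J : Fin N → ℕ → ℕ) (α : Fin N → ℕ → ℝ) (P : Measure Ω)
    (x : ℕ → Ω → Profile n) (τ : Fin N → Fin N → ℕ → Ω → ℕ)
    (ξ : Fin N → ℕ → ℕ → Ω → Noise d) : Prop :=
  ∀ k, ∀ i ∈ I k, (∀ ω, x (k + 1) ω i ∈ G.X i) ∧
    P[fun ω => ‖x (k + 1) ω i - G.proxBR μ i (delayed x τ i k ω)‖ ^ 2 | curField I J x τ ξ k]
      ≤ᵐ[P] fun _ => α i k ^ 2

/-- Each delay `τ_{ij}(k)` in use is independent of the iterates `x_0, …, x_k`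
(for instance, it is deterministic). -/
def DelaysIndep [MeasurableSpace Ω] (I : ℕ → Finset (Fin N)) (P : Measure Ω)
    (x : ℕ → Ω → Profile n) (τ : Fin N → Fin N → ℕ → Ω → ℕ) : Prop :=
  ∀ k, ∀ i ∈ I k, ∀ j, IndepFun (τ i j k) (fun ω (t : Fin (k + 1)) => x t ω) P

/-- A random profile `x` is an `ε`-NE_∞: `max_i 𝔼‖x_i - x_i^*‖ ≤ ε`. -/
def IsEpsNE [MeasurableSpace Ω] (P : Measure Ω) (xstar : Profile n) (ε : ℝ)
    (x : Ω → Profile n) : Prop :=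
  ∀ i, ∫ ω, ‖x ω i - xstar i‖ ∂P ≤ ε

end Protocol

/-! ### The complexity expressions -/

/-- `ε̂ = ε / (C + D) · ρ^{(B - 1) / B}`. -/
def epsHat (ρ C D : ℝ) (B : ℕ) (ε : ℝ) : ℝ := ε / (C + D) * ρ ^ (((B : ℝ) - 1) / B)

/-- Number of major iterations `⌈ln(1/ε̂) / ln(1/q)⌉` (zero if this is negative). -/
def majorIters (ρ C D q : ℝ) (B : ℕ) (ε : ℝ) : ℕ :=
  ⌈Real.log (1 / epsHat ρ C D B ε) / Real.log (1 / q)⌉₊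

/-- `ℓ_i^{(1)}(η)`. -/
def ell₁ (Q η ρ C D q : ℝ) (B₁ : ℕ) (ε : ℝ) : ℝ :=
  Q / (η ^ 4 * Real.log (1 / η ^ 2)) *
      (1 / epsHat ρ C D B₁ ε) ^ (Real.log (1 / η ^ 2) / Real.log (1 / q)) +
    majorIters ρ C D q B₁ ε

/-- `ℓ_i^{(2)}(η)`, with `η̃ = η^{1/N}`. -/
def ell₂ (Q η ρ C D q : ℝ) (N : ℕ) (ε : ℝ) : ℝ :=
  Q / ((η ^ (1 / (N : ℝ))) ^ 2 * η ^ 2 * Real.log (1 / (η ^ (1 / (N : ℝ))) ^ 2)) *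
      (1 / epsHat ρ C D N ε) ^
        (Real.log (1 / (η ^ (1 / (N : ℝ))) ^ 2) / Real.log (1 / q)) +
    majorIters ρ C D q N ε

/-- Inner step numbers `⌈Q_i / η^{2(k+1)}⌉` for the general asynchronous scheme. -/
def stepsAsync {N : ℕ} (Q : Fin N → ℝ) (η : ℝ) (i : Fin N) (k : ℕ) : ℕ :=
  ⌈Q i / η ^ (2 * (k + 1))⌉₊

/-- Inner step numbers `⌈Q_i / η^{2 + 2k/N}⌉` for the cyclic scheme. -/
def stepsCyclic {N : ℕ} (Q : Fin N → ℝ) (η : ℝ) (i : Fin N) (k : ℕ) : ℕ :=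
  ⌈Q i / η ^ (2 + 2 * (k : ℝ) / N)⌉₊

end AsyncBR

end

/-! The proof combines a contraction, a stochastic approximation rate and a bookkeeping of delays.

Contraction. The proximal best response and the Nash equilibrium both solve variational
inequalities. In the own variable the gradient is strongly monotone with constant `zetaMin`; in the
variable of player `j` it is Lipschitz with constant `zetaMax i j`. Adding two such inequalities
gives `norm_sub_le_of_variational`: the distance of two solutions is at most the `i`-th row of Γ
applied to the distances of the data. Diagonal dominance makes every row sum of Γ less than 1, so
exact responses contract towards `xstar` by η in the sup norm.

Inexactness. The regularised problem is μ-strongly monotone, so with steps 1/(μ(t+1)) the mean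
square error after t steps is at most Q/(t+1) (`condExp_inner_le`). The chosen step numbers bring it
below η^(2β), where β counts the updates made so far.

Delays. Put c = η^(1/(B(n₀+1))). One contraction by η = c^(B(n₀+1)) pays for data up to B₂ ≤ B n₀
old, for up to B-1 idle periods, and for one factor c of progress. Hence `async_recursion_bound`:
the distance at time k is at most c^(k-B+1) times an initial term plus the rescaled errors. Each
error is at most c^(l+1), so together they contribute a multiple of k, and k c^k ≤ D q^k for any q
in (c,1) with D = 1/(e ln(q/c)). For delays independent of the iterates the recursion holds for the
means. For arbitrary delays it is run on each sample path and integrated afterwards, which replaces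
C + D by the sum of the diameters plus N D and leaves the rate unchanged.

Complexity. Taking ln(1/q) = 2 ln(1/η)/(2p+δ), with c = η^(1/p), gives D exactly the prescribed
value and turns the ratio of logarithms into the exponent 2p+δ. The displayed bounds on ℓ are
therefore equalities; the number of gradient steps is controlled by a geometric sum. -/

namespace AsyncBR

/-! ### Variational inequalities and contraction of the proximal best response. -/

section Game

open scoped RealInnerProductSpace

theorem lambdaMin_mul_le_inner {m : ℕ}
    (A : EuclideanSpace ℝ (Fin m) →L[ℝ] EuclideanSpace ℝ (Fin m))
    (v : EuclideanSpace ℝ (Fin m)) : lambdaMin A * ‖v‖ ^ 2 ≤ ⟪A v, v⟫ := by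
  rcases eq_or_ne v 0 with rfl | hv
  · simp
  have : Nontrivial (EuclideanSpace ℝ (Fin m)) := ⟨v, 0, hv⟩
  set S : EuclideanSpace ℝ (Fin m) →L[ℝ] EuclideanSpace ℝ (Fin m) :=
    (1 / 2 : ℝ) • (A + ContinuousLinearMap.adjoint A) with hS
  have hSv : ∀ w, ⟪S w, w⟫ = ⟪A w, w⟫ := fun w => by
    simp only [hS, smul_apply, add_apply, inner_smul_left,
      inner_add_left, ContinuousLinearMap.adjoint_inner_left, real_inner_comm w (A w)]
    simp; ring
  have hsa : (S : EuclideanSpace ℝ (Fin m) →ₗ[ℝ] EuclideanSpace ℝ (Fin m)).IsSymmetric := by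
    intro a b
    simp only [hS, ContinuousLinearMap.coe_coe, smul_apply,
      add_apply, inner_smul_left, inner_smul_right,
      inner_add_left, inner_add_right, ContinuousLinearMap.adjoint_inner_left,
      ContinuousLinearMap.adjoint_inner_right]
    simp [add_comm]
  -- The infimum of the Rayleigh quotient of the symmetric part is itself an eigenvalue, so
  -- `lambdaMin` lies below it. The quadratic form sees only the symmetric part, hence no symmetry
  -- of the Hessian has to be proved.
  have hev := hsa.hasEigenvalue_iInf_of_finiteDimensional
  have h1 : lambdaMin A ≤ _ :=
    csInf_le (Module.End.finite_hasEigenvalue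
      (S : EuclideanSpace ℝ (Fin m) →ₗ[ℝ] EuclideanSpace ℝ (Fin m))).bddBelow hev
  have h2 : (⨅ x : {x : EuclideanSpace ℝ (Fin m) // x ≠ 0}, ⟪S x, (x : EuclideanSpace ℝ (Fin m))⟫ /
      ‖(x : EuclideanSpace ℝ (Fin m))‖ ^ 2) ≤ ⟪S v, v⟫ / ‖v‖ ^ 2 := by
    refine ciInf_le ⟨-‖S‖, ?_⟩ (⟨v, hv⟩ : {x : EuclideanSpace ℝ (Fin m) // x ≠ 0})
    rintro _ ⟨⟨w, hw⟩, rfl⟩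
    have hw' : 0 < ‖w‖ := norm_pos_iff.2 hw
    rw [le_div_iff₀ (by positivity)]
    have := (abs_le.1 (abs_real_inner_le_norm (S w) w)).1
    have := mul_le_mul_of_nonneg_right (S.le_opNorm w) hw'.le
    nlinarith
  have hv' : 0 < ‖v‖ := norm_pos_iff.2 hv
  have h3 : lambdaMin A ≤ ⟪S v, v⟫ / ‖v‖ ^ 2 := h1.trans h2
  rwa [le_div_iff₀ (by positivity), hSv] at h3

variable {N : ℕ} {n : Fin N → ℕ} {d : ℕ} {G : StochGame n d} {M : Fin N → ℝ}

namespace StochGame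

theorem update_mem_joint {x : Profile n} (hx : x ∈ G.joint) {i : Fin N} {u : Strat n i}
    (hu : u ∈ G.X i) : Function.update x i u ∈ G.joint := by
  intro j
  rcases eq_or_ne j i with rfl | h
  · simpa using hu
  · simpa [h] using hx j

theorem gradf_update (i : Fin N) (x : Profile n) (u : Strat n i) :
    G.gradf i (Function.update x i u) =
      gradient (fun v : Strat n i => G.f i (Function.update x i v)) u := by
  simp [gradf, partialGrad]

namespace Regular

theorem hasGradientAt (hG : G.Regular M) {x : Profile n} (hx : x ∈ G.joint) {i : Fin N}
    {u : Strat n i} (hu : u ∈ G.X i) :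
    HasGradientAt (fun v : Strat n i => G.f i (Function.update x i v))
      (G.gradf i (Function.update x i u)) u := by
  obtain ⟨U, hU, hXU, -, -, hc⟩ := hG.payoff i x hx
  rw [gradf_update]
  exact ((hc.contDiffAt (hU.mem_nhds (hXU hu))).differentiableAt (by simp)).hasGradientAt

theorem hasFDerivAt_gradf (hG : G.Regular M) {x : Profile n} (hx : x ∈ G.joint) {i : Fin N}
    {u : Strat n i} (hu : u ∈ G.X i) :
    HasFDerivAt (fun v : Strat n i => G.gradf i (Function.update x i v))
      (G.hess i i (Function.update x i u)) u := by
  obtain ⟨U, hU, hXU, -, -, hc⟩ := hG.payoff i x hx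
  have h1 : DifferentiableAt ℝ (fun v : Strat n i => G.gradf i (Function.update x i v)) u := by
    simp only [gradf_update]
    have := ((hc.fderiv_of_isOpen (m := 1) hU (by norm_num)).contDiffAt
      (hU.mem_nhds (hXU hu))).differentiableAt (by simp)
    exact ((InnerProductSpace.toDual ℝ (Strat n i)).symm.toContinuousLinearEquiv
      |>.differentiableAt).comp u this
  have h2 : G.hess i i (Function.update x i u) =
      fderiv ℝ (fun v : Strat n i => G.gradf i (Function.update x i v)) u := by
    simp [hess]
  rw [h2]
  exact h1.hasFDerivAt

end Regular

theorem zetaMax_nonneg (i j : Fin N) : 0 ≤ G.zetaMax i j :=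
  Real.iSup_nonneg fun _ => norm_nonneg _

theorem zetaMin_pos (hdd : G.DiagDominant) (i : Fin N) : 0 < G.zetaMin i :=
  (Finset.sum_nonneg fun j _ => zetaMax_nonneg i j).trans_lt (hdd i)

theorem zetaMin_le (hdd : G.DiagDominant) {x : Profile n} (hx : x ∈ G.joint) (i : Fin N) :
    G.zetaMin i ≤ lambdaMin (G.hess i i x) := by
  -- An infimum over a set unbounded below has the default value 0, which the positivity of
  -- `zetaMin` excludes.
  have hb : BddBelow (Set.range fun x : G.joint => lambdaMin (G.hess i i x)) := by
    by_contra h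
    have := zetaMin_pos hdd i
    rw [zetaMin, Real.iInf_of_not_bddBelow h] at this
    exact lt_irrefl _ this
  exact ciInf_le hb (⟨x, hx⟩ : G.joint)

namespace Regular

/-- The derivative of the inner product along the segment from `v` to `u` is the quadratic form of
the own Hessian, bounded below by `zetaMin`; the mean value theorem then compares the endpoints. -/
theorem strongly_monotone (hG : G.Regular M) (hdd : G.DiagDominant) {x : Profile n}
    (hx : x ∈ G.joint) {i : Fin N} {u v : Strat n i} (hu : u ∈ G.X i) (hv : v ∈ G.X i) :
    G.zetaMin i * ‖u - v‖ ^ 2 ≤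
      ⟪G.gradf i (Function.update x i u) - G.gradf i (Function.update x i v), u - v⟫ := by
  set φ : ℝ → ℝ := fun t => ⟪G.gradf i (Function.update x i (v + t • (u - v))), u - v⟫
  have hmem : ∀ t ∈ Set.Icc (0 : ℝ) 1, v + t • (u - v) ∈ G.X i := fun t ht =>
    (hG.convex i).add_smul_sub_mem hv hu ht
  have hder : ∀ t ∈ Set.Icc (0 : ℝ) 1, HasDerivAt φ
      ⟪G.hess i i (Function.update x i (v + t • (u - v))) (u - v), u - v⟫ t := by
    intro t ht
    have h1 := hG.hasFDerivAt_gradf hx (hmem t ht)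
    have h2 : HasDerivAt (fun t : ℝ => v + t • (u - v)) (u - v) t := by
      simpa using ((hasDerivAt_id t).smul_const (u - v)).const_add v
    have h3 := h1.comp_hasDerivAt t h2
    simpa using h3.inner ℝ (hasDerivAt_const t (u - v))
  have := Convex.mul_sub_le_image_sub_of_le_deriv (convex_Icc (0 : ℝ) 1)
    (f := φ) (fun t ht => (hder t ht).continuousAt.continuousWithinAt)
    (fun t ht => (hder t (interior_subset ht)).differentiableAt.differentiableWithinAt)
    (C := G.zetaMin i * ‖u - v‖ ^ 2)
    (fun t ht => by
      rw [(hder t (interior_subset ht)).deriv]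
      refine le_trans ?_ (lambdaMin_mul_le_inner _ _)
      gcongr
      exact zetaMin_le hdd (update_mem_joint hx (hmem t (interior_subset ht))) i)
    0 (by simp) 1 (by simp) zero_le_one
  simpa [φ, inner_sub_left] using this

theorem norm_gradf_update_sub_le (hG : G.Regular M) {x : Profile n} (hx : x ∈ G.joint)
    {i j : Fin N} (hij : i ≠ j) {u v : Strat n j} (hu : u ∈ G.X j) (hv : v ∈ G.X j) :
    ‖G.gradf i (Function.update x j u) - G.gradf i (Function.update x j v)‖ ≤
      G.zetaMax i j * ‖u - v‖ := by
  refine Convex.norm_image_sub_le_of_norm_hasFDerivWithin_le (𝕜 := ℝ)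
    (f := fun w : Strat n j => G.gradf i (Function.update x j w))
    (f' := fun w => G.hess i j (Function.update x j w)) (fun w hw => ?_) (fun w hw => ?_)
    (hG.convex j) hv hu
  · have := ((hG.mixed i j hij).1 _ (update_mem_joint hx hw)).hasFDerivAt
    simp only [hess]
    simp only [Function.update_idem, Function.update_self] at this ⊢
    exact this.hasFDerivWithinAt
  · exact le_ciSup (hG.mixed i j hij).2 (⟨_, update_mem_joint hx hw⟩ : G.joint)

/-- `∇_{x_i} f_i` is Lipschitz in the strategies of the other players. -/
theorem norm_gradf_sub_le (hG : G.Regular M) {x y : Profile n} (hx : x ∈ G.joint)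
    (hy : y ∈ G.joint) {i : Fin N} (hi : x i = y i) :
    ‖G.gradf i x - G.gradf i y‖ ≤ ∑ j ∈ Finset.univ.erase i, G.zetaMax i j * ‖x j - y j‖ := by
  -- Passes from `y` to `x` by changing one coordinate at a time; the hybrid profiles stay in the
  -- product set, where the one-coordinate bound applies.
  have key : ∀ s : Finset (Fin N), i ∉ s →
      ‖G.gradf i (fun j => if j ∈ s then x j else y j) - G.gradf i y‖ ≤
        ∑ j ∈ s, G.zetaMax i j * ‖x j - y j‖ := by
    intro s
    induction s using Finset.induction_on with
    | empty => simp
    | insert a s ha ih =>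
      intro his
      simp only [Finset.mem_insert, not_or] at his
      have hw : (fun j => if j ∈ s then x j else y j) ∈ G.joint := by
        intro j
        dsimp only
        split_ifs
        exacts [hx j, hy j]
      have e1 : (fun j => if j ∈ insert a s then x j else y j) =
          Function.update (fun j => if j ∈ s then x j else y j) a (x a) := by
        funext j
        rcases eq_or_ne j a with rfl | h
        · simp
        · simp [h]
      have e2 : (fun j => if j ∈ s then x j else y j) =
          Function.update (fun j => if j ∈ s then x j else y j) a (y a) := by
        rw [eq_comm, Function.update_eq_self_iff]
        simp [ha]
      rw [Finset.sum_insert ha]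
      calc _ ≤ ‖G.gradf i (fun j => if j ∈ insert a s then x j else y j) -
              G.gradf i (fun j => if j ∈ s then x j else y j)‖ +
            ‖G.gradf i (fun j => if j ∈ s then x j else y j) - G.gradf i y‖ :=
            norm_sub_le_norm_sub_add_norm_sub _ _ _
        _ ≤ _ := by
            refine add_le_add ?_ (ih his.2)
            rw [e1]
            conv_lhs => rw [e2]
            rw [Function.update_idem]
            exact hG.norm_gradf_update_sub_le hw his.1 (hx a) (hy a)
  have := key (Finset.univ.erase i) (by simp)
  have e : (fun j => if j ∈ Finset.univ.erase i then x j else y j) = x := by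
    funext j
    rcases eq_or_ne j i with rfl | h
    · simp [hi]
    · simp [h]
  rwa [e] at this

/-! ### The proximal best response -/

theorem proxBR_spec (hG : G.Regular M) (μ : ℝ) {y : Profile n} (hy : y ∈ G.joint) (i : Fin N) :
    G.proxBR μ i y ∈ G.X i ∧
      IsMinOn (fun v => G.f i (Function.update y i v) + μ / 2 * ‖v - y i‖ ^ 2) (G.X i)
        (G.proxBR μ i y) := by
  have hcont : ContinuousOn (fun v => G.f i (Function.update y i v) + μ / 2 * ‖v - y i‖ ^ 2)
      (G.X i) := by
    refine ContinuousOn.add (fun v hv => ?_) (by fun_prop)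
    exact (hG.hasGradientAt hy hv).continuousAt.continuousWithinAt
  obtain ⟨u, hu, hmin⟩ := (hG.compact i).exists_isMinOn ⟨y i, hy i⟩ hcont
  exact Classical.epsilon_spec (p := fun u => u ∈ G.X i ∧
    IsMinOn (fun v => G.f i (Function.update y i v) + μ / 2 * ‖v - y i‖ ^ 2) (G.X i) u)
    ⟨u, hu, hmin⟩

theorem variational_of_isMinOn (hG : G.Regular M) (μ : ℝ) {y : Profile n} (hy : y ∈ G.joint)
    {i : Fin N} {u w : Strat n i} (hu : u ∈ G.X i)
    (hmin : IsMinOn (fun v => G.f i (Function.update y i v) + μ / 2 * ‖v - y i‖ ^ 2) (G.X i) u)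
    (hw : w ∈ G.X i) :
    0 ≤ ⟪G.gradf i (Function.update y i u) + μ • (u - y i), w - u⟫ := by
  have h1 := (hG.hasGradientAt hy hu).hasFDerivAt
  have h2 : HasFDerivAt (fun v : Strat n i => μ / 2 * ‖v - y i‖ ^ 2)
      ((μ / 2) • (2 • (innerSL ℝ (u - y i)))) u := by
    simpa using (((hasFDerivAt_id u).sub_const (y i)).norm_sq).const_mul (μ / 2)
  have h3 := hmin.localize.hasFDerivWithinAt_nonneg (h1.add h2).hasFDerivWithinAt
    (sub_mem_posTangentConeAt_of_segment_subset ((hG.convex i).segment_subset hu hw))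
  simp only [add_apply, smul_apply,
    InnerProductSpace.toDual_apply_apply, innerSL_apply_apply] at h3
  rw [inner_add_left, inner_smul_left]
  simp only [conj_trivial, smul_eq_mul, nsmul_eq_mul] at h3 ⊢
  push_cast at h3
  linarith

theorem proxBR_variational (hG : G.Regular M) (μ : ℝ) {y : Profile n} (hy : y ∈ G.joint)
    {i : Fin N} {w : Strat n i} (hw : w ∈ G.X i) :
    0 ≤ ⟪G.gradf i (Function.update y i (G.proxBR μ i y)) + μ • (G.proxBR μ i y - y i),
      w - G.proxBR μ i y⟫ :=
  hG.variational_of_isMinOn μ hy (hG.proxBR_spec μ hy i).1 (hG.proxBR_spec μ hy i).2 hw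

/-- Two solutions of the variational inequalities with data `y`, `y'` are close. -/
theorem norm_sub_le_of_variational (hG : G.Regular M) (hdd : G.DiagDominant) {μ : ℝ} (hμ : 0 < μ)
    {y y' : Profile n} (hy : y ∈ G.joint) (hy' : y' ∈ G.joint) {i : Fin N} {u u' : Strat n i}
    (hu : u ∈ G.X i) (hu' : u' ∈ G.X i)
    (h : 0 ≤ ⟪G.gradf i (Function.update y i u) + μ • (u - y i), u' - u⟫)
    (h' : 0 ≤ ⟪G.gradf i (Function.update y' i u') + μ • (u' - y' i), u - u'⟫) :
    ‖u - u'‖ ≤ ∑ j, G.Gam μ i j * ‖y j - y' j‖ := by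
  have hpos : 0 < μ + G.zetaMin i := add_pos hμ (zetaMin_pos hdd i)
  have hsum : ∑ j, G.Gam μ i j * ‖y j - y' j‖ =
      (μ * ‖y i - y' i‖ + ∑ j ∈ Finset.univ.erase i, G.zetaMax i j * ‖y j - y' j‖) /
        (μ + G.zetaMin i) := by
    rw [← Finset.add_sum_erase _ _ (Finset.mem_univ i), add_div, Finset.sum_div]
    congr 1
    · simp [Gam]; ring
    · refine Finset.sum_congr rfl fun j hj => ?_
      simp [Gam, Finset.ne_of_mem_erase hj]; ring
  rw [hsum, le_div_iff₀ hpos]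
  set g := G.gradf i (Function.update y i u)
  set g' := G.gradf i (Function.update y' i u')
  set g'' := G.gradf i (Function.update y i u')
  set S := ∑ j ∈ Finset.univ.erase i, G.zetaMax i j * ‖y j - y' j‖ with hS
  have hmono := hG.strongly_monotone hdd hy hu hu'
  have hlip : ‖g' - g''‖ ≤ S := by
    refine (hG.norm_gradf_sub_le (update_mem_joint hy' hu') (update_mem_joint hy hu')
      (by simp)).trans (le_of_eq ?_)
    refine Finset.sum_congr rfl fun j hj => ?_
    simp [Finset.ne_of_mem_erase hj, norm_sub_rev (y' j)]
  have e1 : ⟪g - g'', u - u'⟫ + μ * ‖u - u'‖ ^ 2 =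
      ⟪g' - g'', u - u'⟫ + μ * ⟪y i - y' i, u - u'⟫ - ⟪g + μ • (u - y i), u' - u⟫
        - ⟪g' + μ • (u' - y' i), u - u'⟫ := by
    rw [← real_inner_self_eq_norm_sq, ← real_inner_smul_left, ← real_inner_smul_left,
      ← neg_sub u u', inner_neg_right, sub_neg_eq_add, ← inner_add_left, ← inner_add_left,
      ← inner_add_left, ← inner_sub_left]
    congr 1
    simp only [smul_sub]
    abel
  have e2 : ⟪g' - g'', u - u'⟫ ≤ S * ‖u - u'‖ :=
    (real_inner_le_norm _ _).trans (by gcongr)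
  have e3 : μ * ⟪y i - y' i, u - u'⟫ ≤ μ * ‖y i - y' i‖ * ‖u - u'‖ := by
    rw [mul_assoc]
    gcongr
    exact real_inner_le_norm _ _
  -- The estimates bound a multiple of the squared distance by a multiple of the distance, so one
  -- factor is cancelled when it is nonzero.
  rcases (norm_nonneg (u - u')).eq_or_lt with h0 | h0
  · rw [← h0, zero_mul]
    exact add_nonneg (by positivity) ((norm_nonneg _).trans hlip)
  · nlinarith

theorem norm_proxBR_sub_le (hG : G.Regular M) (hdd : G.DiagDominant) {μ : ℝ} (hμ : 0 < μ)
    {y y' : Profile n} (hy : y ∈ G.joint) (hy' : y' ∈ G.joint) (i : Fin N) :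
    ‖G.proxBR μ i y - G.proxBR μ i y'‖ ≤ ∑ j, G.Gam μ i j * ‖y j - y' j‖ :=
  hG.norm_sub_le_of_variational hdd hμ hy hy' (hG.proxBR_spec μ hy i).1 (hG.proxBR_spec μ hy' i).1
    (hG.proxBR_variational μ hy (hG.proxBR_spec μ hy' i).1)
    (hG.proxBR_variational μ hy' (hG.proxBR_spec μ hy i).1)

/-- An equilibrium strategy minimises the payoff, and the proximal term centred at it vanishes
there, so it also minimises the regularised objective and satisfies the same variational inequality
with data `xstar`. -/
theorem norm_proxBR_sub_nash_le (hG : G.Regular M) (hdd : G.DiagDominant) {μ : ℝ} (hμ : 0 < μ)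
    {xstar : Profile n} (hstar : G.IsNash xstar) {y : Profile n} (hy : y ∈ G.joint) (i : Fin N) :
    ‖G.proxBR μ i y - xstar i‖ ≤ ∑ j, G.Gam μ i j * ‖y j - xstar j‖ := by
  refine hG.norm_sub_le_of_variational hdd hμ hy hstar.1 (hG.proxBR_spec μ hy i).1 (hstar.1 i)
    (hG.proxBR_variational μ hy (hstar.1 i))
    (hG.variational_of_isMinOn μ hstar.1 (hstar.1 i) (fun v hv => ?_) (hG.proxBR_spec μ hy i).1)
  have := hstar.2 i v hv
  simp only [Function.update_eq_self, sub_self, norm_zero]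
  have : 0 ≤ μ / 2 * ‖v - xstar i‖ ^ 2 := by positivity
  simp; linarith

end Regular

/-! ### The matrix `Γ` -/

theorem Gam_nonneg (hdd : G.DiagDominant) {μ : ℝ} (hμ : 0 < μ) (i j : Fin N) :
    0 ≤ G.Gam μ i j := by
  have := zetaMin_pos hdd i
  have := zetaMax_nonneg (G := G) i j
  unfold Gam
  split_ifs <;> positivity

theorem aInf_eq (μ : ℝ) :
    G.aInf μ = (Finset.univ.sup fun i => ∑ j, ‖G.Gam μ i j‖₊ : NNReal) :=
  Matrix.linfty_opNorm_def _

theorem sum_Gam_le_aInf (hdd : G.DiagDominant) {μ : ℝ} (hμ : 0 < μ) (i : Fin N) :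
    ∑ j, G.Gam μ i j ≤ G.aInf μ := by
  rw [aInf_eq]
  have h := Finset.le_sup (f := fun i => ∑ j, ‖G.Gam μ i j‖₊) (Finset.mem_univ i)
  have h' : ((∑ j, ‖G.Gam μ i j‖₊ : NNReal) : ℝ) = ∑ j, G.Gam μ i j := by
    push_cast
    exact Finset.sum_congr rfl fun j _ => Real.norm_of_nonneg (Gam_nonneg hdd hμ i j)
  rw [← h']
  exact_mod_cast h

theorem sum_Gam_lt_one (hdd : G.DiagDominant) {μ : ℝ} (hμ : 0 < μ) (i : Fin N) :
    ∑ j, G.Gam μ i j < 1 := by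
  have hpos : 0 < μ + G.zetaMin i := add_pos hμ (zetaMin_pos hdd i)
  have : ∑ j, G.Gam μ i j =
      (μ + ∑ j ∈ Finset.univ.erase i, G.zetaMax i j) / (μ + G.zetaMin i) := by
    rw [← Finset.add_sum_erase _ _ (Finset.mem_univ i), add_div, Finset.sum_div]
    congr 1
    · simp [Gam]
    · refine Finset.sum_congr rfl fun j hj => ?_
      simp [Gam, Finset.ne_of_mem_erase hj]
  rw [this, div_lt_one hpos]
  have := hdd i
  linarith

theorem aInf_lt_one (hdd : G.DiagDominant) {μ : ℝ} (hμ : 0 < μ) : G.aInf μ < 1 := by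
  rw [aInf_eq]
  have : (Finset.univ.sup fun i => ∑ j, ‖G.Gam μ i j‖₊) < 1 := by
    rw [Finset.sup_lt_iff (by simp)]
    intro i _
    rw [← NNReal.coe_lt_coe]
    push_cast
    refine lt_of_eq_of_lt ?_ (sum_Gam_lt_one hdd hμ i)
    exact Finset.sum_congr rfl fun j _ => Real.norm_of_nonneg (Gam_nonneg hdd hμ i j)
  exact_mod_cast this

theorem aInf_pos [NeZero N] (hdd : G.DiagDominant) {μ : ℝ} (hμ : 0 < μ) : 0 < G.aInf μ := by
  have i : Fin N := 0
  refine lt_of_lt_of_le ?_ (sum_Gam_le_aInf hdd hμ i)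
  have := zetaMin_pos hdd i
  refine lt_of_lt_of_le (?_ : 0 < G.Gam μ i i)
    (Finset.single_le_sum (fun j _ => Gam_nonneg hdd hμ i j) (Finset.mem_univ i))
  simp only [Gam, if_true]
  positivity

end StochGame

end Game

/-! ### Euclidean projection: obtuse angle property and nonexpansiveness. -/

section Projection

open scoped RealInnerProductSpace

variable {m : ℕ} {S : Set (EuclideanSpace ℝ (Fin m))}

theorem proj_spec (hS : IsCompact S) (hne : S.Nonempty) (u : EuclideanSpace ℝ (Fin m)) :
    proj S u ∈ S ∧ ∀ w ∈ S, ‖u - proj S u‖ ≤ ‖u - w‖ := by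
  obtain ⟨v, hv, hmin⟩ := hS.exists_isMinOn hne
    (f := fun w => ‖u - w‖) (by fun_prop)
  exact Classical.epsilon_spec (p := fun v => v ∈ S ∧ ∀ w ∈ S, ‖u - v‖ ≤ ‖u - w‖)
    ⟨v, hv, fun w hw => hmin hw⟩

theorem inner_sub_proj_le (hS : IsCompact S) (hc : Convex ℝ S) (u : EuclideanSpace ℝ (Fin m))
    {w : EuclideanSpace ℝ (Fin m)} (hw : w ∈ S) : ⟪u - proj S u, w - proj S u⟫ ≤ 0 := by
  have hne : S.Nonempty := ⟨w, hw⟩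
  obtain ⟨h1, h2⟩ := proj_spec hS hne u
  refine (norm_eq_iInf_iff_real_inner_le_zero hc h1).1 ?_ w hw
  have : Nonempty S := hne.to_subtype
  refine le_antisymm (le_ciInf fun w => h2 w w.2) ?_
  exact ciInf_le (f := fun w : S => ‖u - w‖) ⟨0, by rintro _ ⟨w, rfl⟩; exact norm_nonneg _⟩
    ⟨_, h1⟩

theorem norm_proj_sub_proj_le (hS : IsCompact S) (hc : Convex ℝ S) (hne : S.Nonempty)
    (u v : EuclideanSpace ℝ (Fin m)) : ‖proj S u - proj S v‖ ≤ ‖u - v‖ := by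
  have h1 := inner_sub_proj_le hS hc u (proj_spec hS hne v).1
  have h2 := inner_sub_proj_le hS hc v (proj_spec hS hne u).1
  set p := proj S u
  set r := proj S v
  have h3 : ‖p - r‖ ^ 2 ≤ ⟪u - v, p - r⟫ := by
    have : ⟪u - v, p - r⟫ - ⟪p - r, p - r⟫ = -⟪u - p, r - p⟫ - ⟪v - r, p - r⟫ := by
      rw [← inner_sub_left, ← inner_neg_right, neg_sub, ← inner_sub_left]
      congr 1
      abel
    rw [← real_inner_self_eq_norm_sq]
    linarith
  have h4 := real_inner_le_norm (u - v) (p - r)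
  rcases (norm_nonneg (p - r)).eq_or_lt with h0 | h0
  · rw [← h0]
    exact norm_nonneg _
  · nlinarith

theorem norm_proj_sub_le (hS : IsCompact S) (hc : Convex ℝ S) (u : EuclideanSpace ℝ (Fin m))
    {w : EuclideanSpace ℝ (Fin m)} (hw : w ∈ S) : ‖proj S u - w‖ ≤ ‖u - w‖ := by
  have hne : S.Nonempty := ⟨w, hw⟩
  have h : proj S w = w := by
    have := (proj_spec hS hne w).2 w hw
    rw [sub_self, norm_zero, norm_le_zero_iff, sub_eq_zero] at this
    exact this.symm
  simpa [h] using norm_proj_sub_proj_le hS hc hne u w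

theorem continuous_proj (hS : IsCompact S) (hc : Convex ℝ S) (hne : S.Nonempty) :
    Continuous (proj S) :=
  (LipschitzWith.of_dist_le_mul (K := 1) fun u v => by
    simpa [dist_eq_norm] using norm_proj_sub_proj_le hS hc hne u v).continuous

end Projection

/-! ### One stochastic approximation step under conditional expectation. -/

section ConditionalStep

open scoped RealInnerProductSpace

variable {Ω E : Type*} {m mΩ : MeasurableSpace Ω} {P : Measure Ω} [IsProbabilityMeasure P]
  [NormedAddCommGroup E] [InnerProductSpace ℝ E] [CompleteSpace E]

/-- One step of stochastic approximation for a `μ`-strongly monotone map, conditionally on `m`. -/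
theorem condExp_norm_sq_step_le (hm : m ≤ mΩ) {z u x₀ g h w : Ω → E} {R M μ γ : ℝ}
    (hμ : 0 ≤ μ) (hγ : 0 ≤ γ)
    (hz : StronglyMeasurable[m] z) (hu : StronglyMeasurable[m] u)
    (hx : StronglyMeasurable[m] x₀) (hw : AEStronglyMeasurable w P)
    (hzu : ∀ ω, ‖z ω - u ω‖ ≤ R) (hzx : ∀ ω, ‖z ω - x₀ ω‖ ≤ R) (hwu : ∀ ω, ‖w ω - u ω‖ ≤ R)
    (hg : MemLp g 2 P) (hgh : P[g | m] =ᵐ[P] h)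
    (hgM : P[fun ω => ‖g ω‖ ^ 2 | m] ≤ᵐ[P] fun _ => M ^ 2)
    (hmono : ∀ ω, μ * ‖z ω - u ω‖ ^ 2 ≤ ⟪h ω + μ • (z ω - x₀ ω), z ω - u ω⟫)
    (hstep : ∀ ω, ‖w ω - u ω‖ ≤ ‖(z ω - γ • (g ω + μ • (z ω - x₀ ω))) - u ω‖) :
    P[fun ω => ‖w ω - u ω‖ ^ 2 | m] ≤ᵐ[P] fun ω =>
      (1 - 2 * γ * μ) * ‖z ω - u ω‖ ^ 2 + γ ^ 2 * (2 * M ^ 2 + 2 * μ ^ 2 * R ^ 2) := by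
  have hsq : Integrable (fun ω => ‖g ω‖ ^ 2) P := hg.integrable_norm_pow (by norm_num)
  have hgi : Integrable g P := hg.integrable one_le_two
  -- The squared length of the step is expanded: `A` collects the `m`-measurable terms, `Bf` the
  -- term linear in the sampled gradient. The square of the sum of gradient and proximal term is
  -- bounded by twice the sum of the squares.
  set A : Ω → ℝ := fun ω => ‖z ω - u ω‖ ^ 2 - 2 * γ * μ * ⟪z ω - x₀ ω, z ω - u ω⟫ +
    2 * γ ^ 2 * μ ^ 2 * R ^ 2 with hA
  set Bf : Ω → ℝ := fun ω => innerSL ℝ (z ω - u ω) (g ω) with hB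
  have hzum := hz.sub hu
  have hAm : StronglyMeasurable[m] A :=
    ((hzum.norm.pow 2).sub (((hz.sub hx).inner hzum).const_mul _)).add_const _
  have hinner : ∀ ω, |⟪z ω - x₀ ω, z ω - u ω⟫| ≤ R * R := fun ω =>
    (abs_real_inner_le_norm _ _).trans
      (mul_le_mul (hzx ω) (hzu ω) (norm_nonneg _) ((norm_nonneg _).trans (hzx ω)))
  have hAi : Integrable A P := by
    refine (Integrable.sub ?_ ?_).add (integrable_const _)
    · refine Integrable.of_bound (C := R ^ 2) ((hzum.norm.pow 2).mono hm).aestronglyMeasurable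
        (Eventually.of_forall fun ω => ?_)
      rw [Real.norm_of_nonneg (by positivity)]
      exact pow_le_pow_left₀ (norm_nonneg _) (hzu ω) 2
    · refine Integrable.const_mul (Integrable.of_bound (C := R * R)
        (((hz.sub hx).inner hzum).mono hm).aestronglyMeasurable
        (Eventually.of_forall hinner)) _
  have hBi : Integrable Bf P := by
    refine (hgi.norm.const_mul R).mono' ?_ (Eventually.of_forall fun ω => ?_)
    · exact ((hzum.mono hm).aestronglyMeasurable.inner hgi.aestronglyMeasurable)
    · exact (norm_inner_le_norm _ _).trans (by gcongr; exact hzu ω)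
  have hce : P[A - (2 * γ) • Bf + (2 * γ ^ 2) • (fun ω => ‖g ω‖ ^ 2) | m] =ᵐ[P]
      fun ω => A ω - (2 * γ) * ⟪z ω - u ω, h ω⟫ +
        (2 * γ ^ 2) * (P[fun ω => ‖g ω‖ ^ 2 | m]) ω := by
    -- The `m`-measurable direction is pulled out of the inner product, leaving the conditional mean
    -- of the sample.
    have h1 := condExp_bilin_of_stronglyMeasurable_left (m := m) (innerSL ℝ : E →L[ℝ] E →L[ℝ] ℝ)
      hzum hBi hgi
    filter_upwards [condExp_add (hAi.sub (hBi.smul (2 * γ))) (hsq.smul (2 * γ ^ 2)) m,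
      condExp_sub hAi (hBi.smul (2 * γ)) m, condExp_smul (2 * γ) Bf m (μ := P),
      condExp_smul (2 * γ ^ 2) (fun ω => ‖g ω‖ ^ 2) m (μ := P), h1, hgh] with ω e1 e2 e3 e4 e5 e6
    rw [e1, Pi.add_apply, e2, e4, Pi.sub_apply, e3, Pi.smul_apply, Pi.smul_apply,
      condExp_of_stronglyMeasurable hm hAm hAi]
    simp only [Pi.sub_apply] at e5
    rw [e5, e6]
    rfl
  have hwi : Integrable (fun ω => ‖w ω - u ω‖ ^ 2) P := by
    refine Integrable.of_bound (C := R ^ 2)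
      ((hw.sub (hu.mono hm).aestronglyMeasurable).norm.pow 2)
      (Eventually.of_forall fun ω => ?_)
    rw [Real.norm_of_nonneg (by positivity)]
    exact pow_le_pow_left₀ (norm_nonneg _) (hwu ω) 2
  have hle : (fun ω => ‖w ω - u ω‖ ^ 2) ≤ᵐ[P]
      A - (2 * γ) • Bf + (2 * γ ^ 2) • (fun ω => ‖g ω‖ ^ 2) := by
    refine Eventually.of_forall fun ω => ?_
    simp only [Pi.add_apply, Pi.sub_apply, Pi.smul_apply, smul_eq_mul, hA, hB, innerSL_apply_apply]
    have h1 : ‖w ω - u ω‖ ^ 2 ≤ _ := pow_le_pow_left₀ (norm_nonneg _) (hstep ω) 2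
    have e : z ω - γ • (g ω + μ • (z ω - x₀ ω)) - u ω =
      (z ω - u ω) - γ • (g ω + μ • (z ω - x₀ ω)) := by abel
    rw [e, norm_sub_sq_real (z ω - u ω), inner_smul_right, inner_add_right, inner_smul_right, norm_smul,
      mul_pow, Real.norm_of_nonneg hγ, real_inner_comm (z ω - x₀ ω)] at h1
    have h2 : ‖g ω + μ • (z ω - x₀ ω)‖ ^ 2 ≤ 2 * ‖g ω‖ ^ 2 + 2 * μ ^ 2 * R ^ 2 := by
      have a1 : ‖g ω + μ • (z ω - x₀ ω)‖ ≤ ‖g ω‖ + μ * R := by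
        refine (norm_add_le _ _).trans ?_
        rw [norm_smul, Real.norm_of_nonneg hμ]
        gcongr
        exact hzx ω
      have a2 := pow_le_pow_left₀ (norm_nonneg _) a1 2
      nlinarith [sq_nonneg (‖g ω‖ - μ * R)]
    have h3 := mul_le_mul_of_nonneg_left h2 (sq_nonneg γ)
    linarith
  have hmon := condExp_mono (m := m) hwi
    ((hAi.sub (hBi.smul (2 * γ))).add (hsq.smul (2 * γ ^ 2))) hle
  filter_upwards [hmon, hce, hgM] with ω h1 h2 h3
  refine h1.trans (h2.le.trans ?_)
  have h4 := hmono ω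
  rw [inner_add_left, inner_smul_left, real_inner_comm] at h4
  simp only [conj_trivial] at h4
  have h5 := mul_le_mul_of_nonneg_left h4 (mul_nonneg zero_le_two hγ)
  have h6 := mul_le_mul_of_nonneg_left h3 (mul_nonneg zero_le_two (sq_nonneg γ))
  simp only [hA]
  linarith

end ConditionalStep

/-! ### Measurability of the inner iterates and of the best response. -/

section Measurability

variable {N : ℕ} {n : Fin N → ℕ} {d : ℕ} {G : StochGame n d} {M : Fin N → ℝ}
  {Ω : Type*} [mΩ : MeasurableSpace Ω]

namespace StochGame

theorem sa_mem (hG : G.Regular M) (μ : ℝ) {i : Fin N} (y : Profile n) {x₀ : Strat n i}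
    (hx : x₀ ∈ G.X i) (s : ℕ → Noise d) : ∀ t, G.sa μ i y x₀ s t ∈ G.X i
  | 0 => by simpa [sa] using hx
  | 1 => by simpa [sa] using hx
  | t + 2 => by
    rw [sa]
    exact (proj_spec (hG.compact i) ⟨x₀, hx⟩ _).1

theorem Regular.dist_le_diam (hG : G.Regular M) {i : Fin N} {u v : Strat n i} (hu : u ∈ G.X i)
    (hv : v ∈ G.X i) : ‖u - v‖ ≤ Metric.diam (G.X i) := by
  rw [← dist_eq_norm]
  exact Metric.dist_le_diam_of_mem (hG.compact i).isBounded hu hv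

theorem measurable_update {y : Ω → Profile n} {i : Fin N} {z : Ω → Strat n i}
    (hy : Measurable y) (hz : Measurable z) :
    Measurable fun ω => Function.update (y ω) i (z ω) := by
  refine measurable_pi_iff.2 fun j => ?_
  rcases eq_or_ne j i with rfl | h
  · simpa using hz
  · simpa [h, Function.comp_def] using (measurable_pi_apply j).comp hy

theorem measurable_gradψ (hG : G.Regular M) {i : Fin N} {y : Ω → Profile n} {s : Ω → Noise d}
    (hy : Measurable y) (hs : Measurable s) (hyX : ∀ ω, y ω ∈ G.joint) :
    Measurable fun ω => G.gradψ i (y ω) (s ω) :=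
  (hG.sample_meas i).comp (f := fun ω => ((⟨y ω, hyX ω⟩ : G.joint), s ω))
    ((hy.subtype_mk).prodMk hs)

/-- Only the samples with index below `t` have to be measurable, so that the lemma applies with the
sub-σ-fields of the run in place of the ambient one. -/
theorem measurable_sa (hG : G.Regular M) (μ : ℝ) {i : Fin N} {y : Ω → Profile n}
    {x₀ : Ω → Strat n i} {s : ℕ → Ω → Noise d} (hy : Measurable y) (hx : Measurable x₀)
    (hyX : ∀ ω, y ω ∈ G.joint) (hxX : ∀ ω, x₀ ω ∈ G.X i) :
    ∀ t, (∀ r, 1 ≤ r → r < t → Measurable (s r)) →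
      Measurable fun ω => G.sa μ i (y ω) (x₀ ω) (fun r => s r ω) t
  | 0 => fun _ => by simpa [sa] using hx
  | 1 => fun _ => by simpa [sa] using hx
  | t + 2 => fun hs => by
    have ih := measurable_sa hG μ hy hx hyX hxX (t + 1) (fun r h1 h2 => hs r h1 (by omega))
    -- A sample point supplies the element of `G.X i` that continuity of the projection requires.
    rcases isEmpty_or_nonempty Ω with hΩ | ⟨⟨ω₀⟩⟩
    · exact measurable_of_empty _
    simp only [sa]
    refine (continuous_proj (hG.compact i) (hG.convex i) ⟨_, hxX ω₀⟩).measurable.comp ?_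
    have hg := measurable_gradψ (i := i) hG (measurable_update hy ih) (hs (t + 1) (by omega) (by omega))
      fun ω => update_mem_joint (hyX ω) (sa_mem hG μ _ (hxX ω) _ _)
    fun_prop

theorem Regular.continuous_proxBR (hG : G.Regular M) (hdd : G.DiagDominant) {μ : ℝ} (hμ : 0 < μ)
    (i : Fin N) : Continuous fun y : G.joint => G.proxBR μ i y := by
  refine continuous_iff_continuousAt.2 fun y₀ => ?_
  refine tendsto_iff_norm_sub_tendsto_zero.2 ?_
  have h : Tendsto (fun y : G.joint => ∑ j, G.Gam μ i j * ‖(y : Profile n) j - y₀.1 j‖) (𝓝 y₀)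
      (𝓝 (∑ j, G.Gam μ i j * ‖y₀.1 j - y₀.1 j‖)) := by
    refine Continuous.tendsto (f := fun y : G.joint =>
      ∑ j, G.Gam μ i j * ‖(y : Profile n) j - y₀.1 j‖) ?_ y₀
    exact continuous_finsetSum _ fun j _ => continuous_const.mul
      ((((continuous_apply j).comp continuous_subtype_val).sub continuous_const).norm)
  simp only [sub_self, norm_zero, mul_zero, Finset.sum_const_zero] at h
  exact squeeze_zero (fun _ => norm_nonneg _)
    (fun y => hG.norm_proxBR_sub_le hdd hμ y.2 y₀.2 i) h

theorem measurable_proxBR (hG : G.Regular M) (hdd : G.DiagDominant) {μ : ℝ} (hμ : 0 < μ)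
    (i : Fin N) {y : Ω → Profile n} (hy : Measurable y) (hyX : ∀ ω, y ω ∈ G.joint) :
    Measurable fun ω => G.proxBR μ i (y ω) :=
  (hG.continuous_proxBR hdd hμ i).measurable.comp
    (f := fun ω => (⟨y ω, hyX ω⟩ : G.joint)) hy.subtype_mk

end StochGame

end Measurability

/-! ### Adaptedness of the run to its filtrations. -/

section Run

open scoped RealInnerProductSpace

variable {N : ℕ} {n : Fin N → ℕ} {d : ℕ} {G : StochGame n d} {M : Fin N → ℝ}
  {Ω : Type*} {μ : ℝ} {I : ℕ → Finset (Fin N)} {B₂ : ℕ}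
  {J : Fin N → ℕ → ℕ} {x : ℕ → Ω → Profile n}
  {τ : Fin N → Fin N → ℕ → Ω → ℕ} {ξ : Fin N → ℕ → ℕ → Ω → Noise d}

theorem pastField_mono {k l : ℕ} (h : k ≤ l) :
    pastField I J x τ ξ k ≤ pastField I J x τ ξ l :=
  sup_le le_sup_left (iSup_le fun r => iSup_le fun hr =>
    le_sup_of_le_right (le_iSup_of_le r (le_iSup_of_le (hr.trans_le h) le_rfl)))

theorem pastField_le_curField (k : ℕ) : pastField I J x τ ξ k ≤ curField I J x τ ξ k :=
  le_sup_left

theorem curField_le_innerField (i : Fin N) (k t : ℕ) :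
    curField I J x τ ξ k ≤ innerField I J x τ ξ i k t :=
  le_sup_left

theorem delays_le_pastField_succ {i : Fin N} {k : ℕ} (hi : i ∈ I k) :
    ((⨆ j : Fin N, MeasurableSpace.comap (τ i j k) inferInstance) ⊔
      ⨆ t : ℕ, ⨆ _ : 1 ≤ t ∧ t ≤ J i k, MeasurableSpace.comap (ξ i k t) inferInstance) ≤
      pastField I J x τ ξ (k + 1) :=
  le_sup_of_le_right (le_iSup_of_le k (le_iSup_of_le k.lt_succ_self
    (le_iSup_of_le i (le_iSup_of_le hi le_rfl))))

theorem measurable_profile {m : MeasurableSpace Ω} {f : Ω → Profile n}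
    (h : ∀ i, Measurable[m] fun ω => f ω i) : Measurable[m] f :=
  measurable_pi_iff.2 h

theorem measurable_strategy {m : MeasurableSpace Ω} {f : Ω → Profile n} (h : Measurable[m] f)
    (i : Fin N) : Measurable[m] fun ω => f ω i :=
  (measurable_pi_apply i).comp h

theorem measurable_delayed {m : MeasurableSpace Ω} {i : Fin N} {k : ℕ}
    (hx : ∀ l ≤ k, Measurable[m] (x l)) (hτ : ∀ j, Measurable[m] (τ i j k)) :
    Measurable[m] (delayed x τ i k) := by
  refine measurable_pi_iff.2 fun j => ?_
  -- The random index is handled by joint measurability in index and sample point, which is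
  -- automatic because the index set is countable.
  have h : Measurable fun p : ℕ × Ω => x (k - p.1) p.2 j :=
    measurable_from_prod_countable_right fun r =>
      (measurable_pi_apply j).comp (hx (k - r) (Nat.sub_le _ _))
  exact h.comp ((hτ j).prodMk measurable_id)

namespace IsAsyncRun

variable [mΩ : MeasurableSpace Ω] {P : Measure Ω}

theorem mem_joint (hG : G.Regular M) (hrun : IsAsyncRun G μ M I B₂ J P x τ ξ) (k : ℕ) (ω : Ω) :
    x k ω ∈ G.joint := by
  induction k with
  | zero => exact hrun.init_mem ω
  | succ k ih =>
    intro i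
    by_cases hi : i ∈ I k
    · rw [hrun.update k i hi]
      exact StochGame.sa_mem hG μ _ (ih i) _ _
    · rw [hrun.stay k i hi]
      exact ih i

theorem delayed_mem (hG : G.Regular M) (hrun : IsAsyncRun G μ M I B₂ J P x τ ξ) (i : Fin N)
    (k : ℕ) (ω : Ω) : delayed x τ i k ω ∈ G.joint :=
  fun j => hrun.mem_joint hG _ ω j

/-- The induction is strong because an update reads iterates of all earlier times through the
delays. -/
theorem measurable_iterate_pastField (hG : G.Regular M)
    (hrun : IsAsyncRun G μ M I B₂ J P x τ ξ) (k : ℕ) :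
    Measurable[pastField I J x τ ξ k] (x k) := by
  induction k using Nat.strong_induction_on with
  | _ k ih =>
    rcases k with _ | k
    · exact (comap_measurable (x 0)).mono le_sup_left le_rfl
    have hpast : ∀ l ≤ k, Measurable[pastField I J x τ ξ (k + 1)] (x l) := fun l hl =>
      (ih l (by omega)).mono (pastField_mono (by omega)) le_rfl
    refine measurable_profile fun i => ?_
    have hxi : Measurable[pastField I J x τ ξ (k + 1)] fun ω => x k ω i :=
      measurable_strategy (hpast k le_rfl) i
    by_cases hi : i ∈ I k
    · have e : (fun ω => x (k + 1) ω i) = inner G μ x τ ξ i k (J i k) :=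
        funext fun ω => hrun.update k i hi ω
      rw [e]
      have hle := delays_le_pastField_succ (J := J) (x := x) (τ := τ) (ξ := ξ) hi
      refine StochGame.measurable_sa (mΩ := pastField I J x τ ξ (k + 1)) hG μ
        (measurable_delayed hpast fun j => ?_) hxi (hrun.delayed_mem hG i k)
        (fun ω => hrun.mem_joint hG k ω i) _ fun r h1 h2 => ?_
      · exact (comap_measurable (τ i j k)).mono
          ((le_sup_of_le_left (le_iSup (fun j : Fin N =>
            MeasurableSpace.comap (τ i j k) inferInstance) j)).trans hle) le_rfl
      · refine (comap_measurable (ξ i k r)).mono (le_trans ?_ hle) le_rfl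
        refine le_sup_of_le_right ?_
        exact le_iSup₂_of_le (f := fun t (_ : 1 ≤ t ∧ t ≤ J i k) =>
          MeasurableSpace.comap (ξ i k t) inferInstance) r ⟨h1, h2.le⟩ le_rfl
    · have e : (fun ω => x (k + 1) ω i) = fun ω => x k ω i :=
        funext fun ω => hrun.stay k i hi ω
      rw [e]
      exact hxi

theorem pastField_le (hrun : IsAsyncRun G μ M I B₂ J P x τ ξ) (k : ℕ) :
    pastField I J x τ ξ k ≤ mΩ :=
  sup_le hrun.init_meas.comap_le (iSup_le fun l => iSup_le fun _ => iSup_le fun i =>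
    iSup_le fun _ => sup_le (iSup_le fun j => (hrun.delay_meas i j l).comap_le)
      (iSup_le fun t => iSup_le fun _ => (hrun.sample_meas i l t).comap_le))

theorem curField_le (hrun : IsAsyncRun G μ M I B₂ J P x τ ξ) (k : ℕ) :
    curField I J x τ ξ k ≤ mΩ :=
  sup_le (hrun.pastField_le k) (iSup_le fun i => iSup_le fun _ => iSup_le fun j =>
    (hrun.delay_meas i j k).comap_le)

theorem innerField_le (hrun : IsAsyncRun G μ M I B₂ J P x τ ξ) (i : Fin N) (k t : ℕ) :
    innerField I J x τ ξ i k t ≤ mΩ :=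
  sup_le (hrun.curField_le k) (iSup_le fun s => iSup_le fun _ => (hrun.sample_meas i k s).comap_le)

theorem measurable_iterate (hG : G.Regular M) (hrun : IsAsyncRun G μ M I B₂ J P x τ ξ) (k : ℕ) :
    Measurable (x k) :=
  (hrun.measurable_iterate_pastField hG k).mono (hrun.pastField_le k) le_rfl

theorem measurable_iterate_curField (hG : G.Regular M)
    (hrun : IsAsyncRun G μ M I B₂ J P x τ ξ) {l k : ℕ} (h : l ≤ k) :
    Measurable[curField I J x τ ξ k] (x l) :=
  (hrun.measurable_iterate_pastField hG l).mono
    ((pastField_mono h).trans (pastField_le_curField k)) le_rfl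

theorem measurable_delayed_curField (hG : G.Regular M)
    (hrun : IsAsyncRun G μ M I B₂ J P x τ ξ) {i : Fin N} {k : ℕ} (hi : i ∈ I k) :
    Measurable[curField I J x τ ξ k] (delayed x τ i k) :=
  measurable_delayed (fun _ hl => hrun.measurable_iterate_curField hG hl) fun j =>
    (comap_measurable (τ i j k)).mono
      (le_sup_of_le_right (le_iSup_of_le i (le_iSup_of_le hi (le_iSup_of_le j le_rfl)))) le_rfl

theorem measurable_proxBR_curField (hG : G.Regular M) (hdd : G.DiagDominant) (hμ : 0 < μ)
    (hrun : IsAsyncRun G μ M I B₂ J P x τ ξ) {i : Fin N} {k : ℕ} (hi : i ∈ I k) :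
    Measurable[curField I J x τ ξ k] fun ω => G.proxBR μ i (delayed x τ i k ω) :=
  StochGame.measurable_proxBR (mΩ := curField I J x τ ξ k) hG hdd hμ i
    (hrun.measurable_delayed_curField hG hi) (hrun.delayed_mem hG i k)

theorem measurable_inner_innerField (hG : G.Regular M)
    (hrun : IsAsyncRun G μ M I B₂ J P x τ ξ) {i : Fin N} {k : ℕ} (hi : i ∈ I k) (t : ℕ) :
    Measurable[innerField I J x τ ξ i k t] (inner G μ x τ ξ i k t) :=
  StochGame.measurable_sa (mΩ := innerField I J x τ ξ i k t) hG μ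
    ((hrun.measurable_delayed_curField hG hi).mono (curField_le_innerField i k t) le_rfl)
    (measurable_strategy ((hrun.measurable_iterate_curField hG le_rfl).mono
      (curField_le_innerField i k t) le_rfl) i)
    (hrun.delayed_mem hG i k) (fun ω => hrun.mem_joint hG k ω i) _ fun r h1 h2 =>
    (comap_measurable (ξ i k r)).mono
      (le_sup_of_le_right (le_iSup_of_le r (le_iSup_of_le (show 1 ≤ r ∧ r < t from ⟨h1, h2⟩) le_rfl))) le_rfl

theorem inner_mem (hG : G.Regular M) (hrun : IsAsyncRun G μ M I B₂ J P x τ ξ) (i : Fin N)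
    (k t : ℕ) (ω : Ω) : inner G μ x τ ξ i k t ω ∈ G.X i :=
  StochGame.sa_mem hG μ _ (hrun.mem_joint hG k ω i) _ t

end IsAsyncRun

end Run

/-! ### The O(1/t) rate of the inner loop and the resulting inexactness. -/

section InexactBestResponse

open scoped RealInnerProductSpace

variable {N : ℕ} {n : Fin N → ℕ} {d : ℕ} {G : StochGame n d} {M : Fin N → ℝ}
  {Ω : Type*} {μ : ℝ} {I : ℕ → Finset (Fin N)} {B₂ : ℕ}
  {J : Fin N → ℕ → ℕ} {x : ℕ → Ω → Profile n}
  {τ : Fin N → Fin N → ℕ → Ω → ℕ} {ξ : Fin N → ℕ → ℕ → Ω → Noise d}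

theorem StochGame.Q_nonneg (μ : ℝ) (i : Fin N) : 0 ≤ G.Q μ M i := by
  unfold StochGame.Q
  positivity

theorem StochGame.Q_pos (hG : G.Regular M) (hμ : 0 < μ) (i : Fin N) : 0 < G.Q μ M i := by
  have := hG.bound_pos i
  unfold StochGame.Q
  positivity

/-- The payoff contributes a nonnegative term, which is discarded: the modulus μ of the proximal
term alone matches the step sizes 1/(μ(t+1)). -/
theorem StochGame.Regular.proxBR_strongly_monotone (hG : G.Regular M) (hdd : G.DiagDominant)
    {y : Profile n} (hy : y ∈ G.joint) {i : Fin N} {z : Strat n i}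
    (hz : z ∈ G.X i) :
    μ * ‖z - G.proxBR μ i y‖ ^ 2 ≤
      ⟪G.gradf i (Function.update y i z) + μ • (z - y i), z - G.proxBR μ i y⟫ := by
  have h1 := hG.proxBR_variational μ hy hz
  have h2 := hG.strongly_monotone hdd hy hz (hG.proxBR_spec μ hy i).1
  have h3 : 0 ≤ G.zetaMin i * ‖z - G.proxBR μ i y‖ ^ 2 :=
    mul_nonneg (StochGame.zetaMin_pos hdd i).le (sq_nonneg _)
  set u := G.proxBR μ i y
  have h4 : ⟪G.gradf i (Function.update y i z) + μ • (z - y i), z - u⟫ =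
      ⟪G.gradf i (Function.update y i z) - G.gradf i (Function.update y i u), z - u⟫ +
      ⟪G.gradf i (Function.update y i u) + μ • (u - y i), z - u⟫ + μ * ‖z - u‖ ^ 2 := by
    rw [← real_inner_self_eq_norm_sq, ← real_inner_smul_left, ← inner_add_left, ← inner_add_left]
    congr 1
    simp only [smul_sub]
    abel
  linarith

namespace IsAsyncRun

variable [mΩ : MeasurableSpace Ω] {P : Measure Ω}

theorem measurable_inner (hG : G.Regular M) (hrun : IsAsyncRun G μ M I B₂ J P x τ ξ)
    {i : Fin N} {k : ℕ} (hi : i ∈ I k) (t : ℕ) : Measurable (inner G μ x τ ξ i k t) :=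
  (hrun.measurable_inner_innerField hG hi t).mono (hrun.innerField_le i k t) le_rfl

theorem measurable_proxBR_delayed (hG : G.Regular M) (hdd : G.DiagDominant) (hμ : 0 < μ)
    (hrun : IsAsyncRun G μ M I B₂ J P x τ ξ) {i : Fin N} {k : ℕ} (hi : i ∈ I k) :
    Measurable fun ω => G.proxBR μ i (delayed x τ i k ω) :=
  (hrun.measurable_proxBR_curField hG hdd hμ hi).mono (hrun.curField_le k) le_rfl

theorem delayed_self (hrun : IsAsyncRun G μ M I B₂ J P x τ ξ) (i : Fin N) (k : ℕ) (ω : Ω) :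
    delayed x τ i k ω i = x k ω i := by
  simp [delayed, hrun.delay_self]

variable [IsProbabilityMeasure P]

theorem integrable_norm_inner_sub_sq (hG : G.Regular M) (hdd : G.DiagDominant) (hμ : 0 < μ)
    (hrun : IsAsyncRun G μ M I B₂ J P x τ ξ) {i : Fin N} {k : ℕ} (hi : i ∈ I k) (t : ℕ) :
    Integrable (fun ω => ‖inner G μ x τ ξ i k t ω - G.proxBR μ i (delayed x τ i k ω)‖ ^ 2) P := by
  refine Integrable.of_bound (C := Metric.diam (G.X i) ^ 2) ?_ (Eventually.of_forall fun ω => ?_)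
  · exact (((hrun.measurable_inner hG hi t).sub
      (hrun.measurable_proxBR_delayed hG hdd hμ hi)).norm.pow_const 2).aestronglyMeasurable
  · rw [Real.norm_of_nonneg (by positivity)]
    exact pow_le_pow_left₀ (norm_nonneg _) (hG.dist_le_diam (hrun.inner_mem hG i k t ω)
      (hG.proxBR_spec μ (hrun.delayed_mem hG i k ω) i).1) 2

/-- With γ = 1/(μ(t+1)) and R the diameter, 2γμ = 2/(t+1) and γ²(2M² + 2μ²R²) = Q/(t+1)²; this is
where the form of `Q` comes from. -/
theorem condExp_inner_step (hG : G.Regular M) (hdd : G.DiagDominant) (hμ : 0 < μ)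
    (hrun : IsAsyncRun G μ M I B₂ J P x τ ξ) {i : Fin N} {k : ℕ} (hi : i ∈ I k) {t : ℕ}
    (h1 : 1 ≤ t) (ht : t ≤ J i k) :
    P[fun ω => ‖inner G μ x τ ξ i k (t + 1) ω - G.proxBR μ i (delayed x τ i k ω)‖ ^ 2 |
        innerField I J x τ ξ i k t] ≤ᵐ[P] fun ω =>
      (1 - 2 / ((t : ℝ) + 1)) *
        ‖inner G μ x τ ξ i k t ω - G.proxBR μ i (delayed x τ i k ω)‖ ^ 2 +
      G.Q μ M i / ((t : ℝ) + 1) ^ 2 := by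
  have hcur := curField_le_innerField (I := I) (J := J) (x := x) (τ := τ) (ξ := ξ) i k t
  have hprox : ∀ ω, G.proxBR μ i (delayed x τ i k ω) ∈ G.X i := fun ω =>
    (hG.proxBR_spec μ (hrun.delayed_mem hG i k ω) i).1
  have key := condExp_norm_sq_step_le (hrun.innerField_le i k t)
    (z := inner G μ x τ ξ i k t) (u := fun ω => G.proxBR μ i (delayed x τ i k ω))
    (x₀ := fun ω => x k ω i) (w := inner G μ x τ ξ i k (t + 1)) (R := Metric.diam (G.X i))
    (M := M i) (μ := μ) (γ := 1 / (μ * ((t : ℝ) + 1))) hμ.le (by positivity)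
    (hrun.measurable_inner_innerField hG hi t).stronglyMeasurable
    ((hrun.measurable_proxBR_curField hG hdd hμ hi).mono hcur le_rfl).stronglyMeasurable
    ((measurable_strategy (hrun.measurable_iterate_curField hG le_rfl) i).mono hcur
      le_rfl).stronglyMeasurable
    (hrun.measurable_inner hG hi (t + 1)).aestronglyMeasurable
    (fun ω => hG.dist_le_diam (hrun.inner_mem hG i k t ω) (hprox ω))
    (fun ω => hG.dist_le_diam (hrun.inner_mem hG i k t ω) (hrun.mem_joint hG k ω i))
    (fun ω => hG.dist_le_diam (hrun.inner_mem hG i k (t + 1) ω) (hprox ω))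
    (hrun.sample_sq k i hi t h1 ht) (hrun.sample_unbiased k i hi t h1 ht)
    (hrun.sample_bound k i hi t h1 ht)
    (fun ω => by
      have := hG.proxBR_strongly_monotone (μ := μ) hdd (hrun.delayed_mem hG i k ω)
        (hrun.inner_mem hG i k t ω)
      rwa [hrun.delayed_self] at this)
    (fun ω => by
      obtain ⟨r, rfl⟩ := Nat.exists_eq_add_of_le' h1
      refine (norm_proj_sub_le (hG.compact i) (hG.convex i) _ (hprox ω)).trans (le_of_eq ?_)
      simp only [inner])
  refine key.trans (Eventually.of_forall fun ω => le_of_eq ?_)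
  have ht' : (0 : ℝ) < (t : ℝ) + 1 := by positivity
  simp only [StochGame.Q]
  congr 1
  · congr 1
    field_simp
  · field_simp

/-- The projected stochastic gradient iterates satisfy `𝔼[‖z_t - x̂_i‖² | 𝓕_k] ≤ Q_i / (t + 1)`. -/
theorem condExp_inner_le (hG : G.Regular M) (hdd : G.DiagDominant) (hμ : 0 < μ)
    (hrun : IsAsyncRun G μ M I B₂ J P x τ ξ) {i : Fin N} {k : ℕ} (hi : i ∈ I k) {t : ℕ}
    (h1 : 1 ≤ t) (ht : t ≤ J i k) :
    P[fun ω => ‖inner G μ x τ ξ i k t ω - G.proxBR μ i (delayed x τ i k ω)‖ ^ 2 |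
        curField I J x τ ξ k] ≤ᵐ[P] fun _ => G.Q μ M i / ((t : ℝ) + 1) := by
  have hQ := StochGame.Q_pos hG hμ i
  induction t, h1 using Nat.le_induction with
  -- At t = 1 the bound Q/2 already dominates the squared diameter.
  | base =>
    have := condExp_mono (m := curField I J x τ ξ k)
      (hrun.integrable_norm_inner_sub_sq hG hdd hμ hi 1)
      (integrable_const (G.Q μ M i / ((1 : ℕ) + 1 : ℝ))) (Eventually.of_forall fun ω => by
        have h := pow_le_pow_left₀ (norm_nonneg _) (hG.dist_le_diam (hrun.inner_mem hG i k 1 ω)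
          (hG.proxBR_spec μ (hrun.delayed_mem hG i k ω) i).1) 2
        have h2 : 0 ≤ M i ^ 2 / μ ^ 2 := by positivity
        refine h.trans ?_
        simp only [StochGame.Q, mul_div_assoc]
        push_cast
        linarith)
    rwa [condExp_const (hrun.curField_le k)] at this
  | succ t h1 ih =>
    have ih := ih (by omega)
    have hint := hrun.integrable_norm_inner_sub_sq hG hdd hμ hi
    have hcur := curField_le_innerField (I := I) (J := J) (x := x) (τ := τ) (ξ := ξ) i k t
    set F : ℕ → Ω → ℝ := fun t ω =>
      ‖inner G μ x τ ξ i k t ω - G.proxBR μ i (delayed x τ i k ω)‖ ^ 2 with hF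
    set a : ℝ := 1 - 2 / ((t : ℝ) + 1) with ha
    set b : ℝ := G.Q μ M i / ((t : ℝ) + 1) ^ 2 with hb
    have ht0 : (1 : ℝ) ≤ t := by exact_mod_cast h1
    have ha0 : 0 ≤ a := by
      rw [ha, sub_nonneg, div_le_one (by positivity)]
      linarith
    have hstep := condExp_mono (m := curField I J x τ ξ k) integrable_condExp
      (((hint t).const_mul a).add (integrable_const b))
      (hrun.condExp_inner_step hG hdd hμ hi h1 (by omega))
    have htower := condExp_condExp_of_le (μ := P) (f := F (t + 1)) hcur (hrun.innerField_le i k t)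
    have hadd := condExp_add (μ := P) ((hint t).smul a) (integrable_const b)
      (curField I J x τ ξ k)
    have hsmul := condExp_smul (μ := P) a (F t) (curField I J x τ ξ k)
    filter_upwards [ih, hstep, htower, hadd, hsmul] with ω e1 e2 e3 e4 e5
    rw [← e3]
    refine e2.trans ?_
    have e6 : (P[(fun ω => a * F t ω) + fun _ => b | curField I J x τ ξ k]) ω =
        a * (P[F t | curField I J x τ ξ k]) ω + b := by
      rw [condExp_const (hrun.curField_le k)] at e4
      refine e4.trans ?_
      rw [Pi.add_apply]
      congr 1
    refine e6.le.trans ((add_le_add_left (mul_le_mul_of_nonneg_left e1 ha0) b).trans ?_)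
    -- The recursion yields Q t/(t+1)², and t(t+2) ≤ (t+1)² closes the induction.
    have e7 : a * (G.Q μ M i / ((t : ℝ) + 1)) + b = G.Q μ M i * (t / ((t : ℝ) + 1) ^ 2) := by
      rw [ha, hb]
      field_simp
      ring
    rw [e7, div_eq_mul_one_div (G.Q μ M i)]
    refine mul_le_mul_of_nonneg_left ?_ hQ.le
    rw [div_le_div_iff₀ (by positivity) (by positivity)]
    push_cast
    nlinarith

/-- The run is an inexact proximal best-response scheme as soon as the numbers of inner steps are
large enough. -/
theorem isInexactBR (hG : G.Regular M) (hdd : G.DiagDominant) (hμ : 0 < μ)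
    (hrun : IsAsyncRun G μ M I B₂ J P x τ ξ) {α : Fin N → ℕ → ℝ}
    (hJ : ∀ k, ∀ i ∈ I k, G.Q μ M i ≤ α i k ^ 2 * J i k) :
    IsInexactBR G μ I J α P x τ ξ := by
  intro k i hi
  refine ⟨fun ω => hrun.mem_joint hG (k + 1) ω i, ?_⟩
  have hQ := StochGame.Q_pos hG hμ i
  have hJ1 : 1 ≤ J i k := by
    rw [Nat.one_le_iff_ne_zero]
    intro h
    have := hJ k i hi
    rw [h, Nat.cast_zero, mul_zero] at this
    linarith
  have h := hrun.condExp_inner_le hG hdd hμ hi hJ1 le_rfl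
  have e : (fun ω => ‖x (k + 1) ω i - G.proxBR μ i (delayed x τ i k ω)‖ ^ 2) = fun ω =>
      ‖inner G μ x τ ξ i k (J i k) ω - G.proxBR μ i (delayed x τ i k ω)‖ ^ 2 := by
    funext ω
    rw [hrun.update k i hi]
  rw [e]
  refine h.trans (Eventually.of_forall fun ω => ?_)
  dsimp only
  rw [div_le_iff₀ (by positivity)]
  have := hJ k i hi
  nlinarith [sq_nonneg (α i k)]

/-- Mean distance between an inexact and the exact best response. -/
theorem integral_norm_sub_proxBR_le (hG : G.Regular M) (hdd : G.DiagDominant) (hμ : 0 < μ)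
    (hrun : IsAsyncRun G μ M I B₂ J P x τ ξ) {α : Fin N → ℕ → ℝ}
    (hα : IsInexactBR G μ I J α P x τ ξ) {i : Fin N} {k : ℕ} (hi : i ∈ I k) (h0 : 0 ≤ α i k) :
    ∫ ω, ‖x (k + 1) ω i - G.proxBR μ i (delayed x τ i k ω)‖ ∂P ≤ α i k := by
  set f : Ω → ℝ := fun ω => ‖x (k + 1) ω i - G.proxBR μ i (delayed x τ i k ω)‖ with hf
  have hfm : Measurable f := ((measurable_strategy (hrun.measurable_iterate hG (k + 1)) i).sub
    (hrun.measurable_proxBR_delayed hG hdd hμ hi)).norm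
  have hfb : ∀ ω, ‖f ω‖ ≤ Metric.diam (G.X i) := fun ω => by
    rw [hf, norm_norm]
    exact hG.dist_le_diam (hrun.mem_joint hG (k + 1) ω i)
      (hG.proxBR_spec μ (hrun.delayed_mem hG i k ω) i).1
  have hf2 : MemLp f 2 P := MemLp.of_bound hfm.aestronglyMeasurable _ (Eventually.of_forall hfb)
  have h1 : ∫ ω, f ω ^ 2 ∂P ≤ α i k ^ 2 := by
    rw [← integral_condExp (hrun.curField_le k)]
    refine (integral_mono_ae integrable_condExp (integrable_const _) (hα k i hi).2).trans ?_
    simp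
  -- Nonnegativity of the variance gives Jensen's inequality (𝔼f)² ≤ 𝔼f².
  have h2 := variance_nonneg f P
  rw [variance_eq_sub hf2] at h2
  have h3 : (∫ ω, f ω ∂P) ^ 2 ≤ α i k ^ 2 := by
    have : P[f ^ 2] = ∫ ω, f ω ^ 2 ∂P := rfl
    linarith
  exact (le_abs_self _).trans (abs_le_of_sq_le_sq h3 h0)

end IsAsyncRun

end InexactBestResponse

/-! ### Update counts and the delayed recursion. -/

section Updates

variable {N : ℕ} {I : ℕ → Finset (Fin N)} {B : ℕ}

theorem le_card_updates (hI : UpdatesWithin I B) (i : Fin N) :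
    ∀ j k, j * B ≤ k → j ≤ ((Finset.range k).filter fun l => i ∈ I l).card
  | 0, _, _ => Nat.zero_le _
  | j + 1, k, h => by
    rw [Nat.succ_mul] at h
    obtain ⟨l, h1, h2, h3⟩ := hI i (k - B)
    have ih := le_card_updates hI i j (k - B) (by omega)
    have hsub : insert l ((Finset.range (k - B)).filter fun l => i ∈ I l) ⊆
        (Finset.range k).filter fun l => i ∈ I l := by
      refine Finset.insert_subset (by simp [h3]; omega) ?_
      exact Finset.filter_subset_filter _ (Finset.range_subset_range.2 (Nat.sub_le _ _))
    have := Finset.card_le_card hsub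
    rw [Finset.card_insert_of_notMem (by simp; omega)] at this
    omega

theorem div_lt_updateCount (hI : UpdatesWithin I B) {i : Fin N} {k : ℕ} (hi : i ∈ I k) :
    k / B < updateCount I i k := by
  rw [updateCount, Finset.range_add_one, Finset.filter_insert, if_pos hi,
    Finset.card_insert_of_notMem (by simp)]
  exact Nat.lt_succ_of_le (le_card_updates hI i _ _ (Nat.div_mul_le_self k B))

theorem updateCount_le (I : ℕ → Finset (Fin N)) (i : Fin N) (k : ℕ) :
    updateCount I i k ≤ k + 1 :=
  (Finset.card_filter_le _ _).trans (by simp)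

theorem UpdatesCyclically.updatesWithin [NeZero N] (hI : UpdatesCyclically I) :
    UpdatesWithin I N := by
  obtain ⟨σ, hσ⟩ := hI
  intro i k
  refine ⟨k + (σ.symm i - Fin.ofNat N k).val, Nat.le_add_right _ _,
    Nat.add_lt_add_left (Fin.isLt _) _, ?_⟩
  have h : ∀ a : Fin N, Fin.ofNat N (k + a.val) = Fin.ofNat N k + a := fun a => by
    ext
    simp [Fin.ofNat, Fin.val_add]
  rw [hσ, Finset.mem_singleton, h, add_sub_cancel, Equiv.apply_symm_apply]

/-- All updates of a player fall in one residue class mod `N`, so the quotient by `N` separates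
them. -/
theorem UpdatesCyclically.updateCount_le [NeZero N] (hI : UpdatesCyclically I) (i : Fin N)
    (k : ℕ) : updateCount I i k ≤ k / N + 1 := by
  obtain ⟨σ, hσ⟩ := hI
  have hmem : ∀ l, i ∈ I l → l % N = (σ.symm i).val := fun l hl => by
    rw [hσ, Finset.mem_singleton] at hl
    rw [hl, Equiv.symm_apply_apply]
    simp [Fin.ofNat]
  rw [updateCount, ← Finset.card_range (k / N + 1)]
  refine Finset.card_le_card_of_injOn (fun l => l / N) (fun l hl => ?_) (fun l hl l' hl' h => ?_)
  · simp only [Finset.coe_filter, Finset.mem_range, Set.mem_ofPred_eq, Finset.coe_range,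
      Set.mem_Iio] at hl ⊢
    exact Nat.lt_succ_of_le (Nat.div_le_div_right (by omega))
  · simp only [Finset.coe_filter, Finset.mem_range, Set.mem_ofPred_eq] at hl hl'
    rw [← Nat.div_add_mod l N, ← Nat.div_add_mod l' N, hmem l hl.2, hmem l' hl'.2]
    simp only at h
    rw [h]

theorem last_update {v : ℕ → ℝ} {i : Fin N} (hstay : ∀ k, i ∉ I k → v (k + 1) = v k) (k : ℕ) :
    (v k = v 0 ∧ ∀ l < k, i ∉ I l) ∨
      ∃ l < k, i ∈ I l ∧ v k = v (l + 1) ∧ ∀ l', l < l' → l' < k → i ∉ I l' := by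
  induction k with
  | zero => exact Or.inl ⟨rfl, by simp⟩
  | succ k ih =>
    by_cases hi : i ∈ I k
    · exact Or.inr ⟨k, k.lt_succ_self, hi, rfl, fun l' h1 h2 => by omega⟩
    rcases ih with ⟨h1, h2⟩ | ⟨l, h1, h2, h3, h4⟩
    · refine Or.inl ⟨(hstay k hi).trans h1, fun l hl => ?_⟩
      rcases Nat.lt_succ_iff_lt_or_eq.1 hl with h | rfl
      exacts [h2 l h, hi]
    · refine Or.inr ⟨l, by omega, h2, (hstay k hi).trans h3, fun l' h5 h6 => ?_⟩
      rcases Nat.lt_succ_iff_lt_or_eq.1 h6 with h | rfl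
      exacts [h4 l' h5 h, hi]

/-- Geometric decay of a nonnegative asynchronous recursion with delays bounded by `B₂`. -/
theorem async_recursion_bound {B₂ n₀ : ℕ} {c C : ℝ} (hc : 0 < c) (hc1 : c ≤ 1) (hB : 0 < B)
    (hI : UpdatesWithin I B) (hB₂ : B₂ ≤ B * n₀) (hC : 0 ≤ C) {e : ℕ → ℝ} (he : ∀ l, 0 ≤ e l)
    {v : Fin N → ℕ → ℝ} (hv0 : ∀ i, v i 0 ≤ C)
    (hstay : ∀ k i, i ∉ I k → v i (k + 1) = v i k)
    (hupd : ∀ k, ∀ i ∈ I k, ∀ V, (∀ j m, m ≤ k → k ≤ m + B₂ → v j m ≤ V) →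
      v i (k + 1) ≤ e k + c ^ (B * (n₀ + 1)) * V) (k : ℕ) (i : Fin N) :
    v i k * c ^ (B - 1) ≤ c ^ k * (C + ∑ l ∈ Finset.range k, e l / c ^ (l + 1)) := by
  set S : ℕ → ℝ := fun k => ∑ l ∈ Finset.range k, e l / c ^ (l + 1) with hS
  have hS0 : ∀ k, 0 ≤ S k := fun k => Finset.sum_nonneg fun l _ => div_nonneg (he l) (by positivity)
  have hSmono : Monotone S := monotone_nat_of_le_succ fun k => by
    simp only [hS, Finset.sum_range_succ]
    exact le_add_of_nonneg_right (div_nonneg (he k) (by positivity))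
  induction k using Nat.strong_induction_on generalizing i with
  | _ k ih =>
    rcases last_update (I := I) (v := v i) (i := i) (fun k => hstay k i) k with
      ⟨h1, h2⟩ | ⟨l, hlk, hil, hv, hlast⟩
    -- A player that has not moved yet is still inside the first window; the factor c^(B-1) absorbs
    -- this idle time.
    · have hk : k ≤ B - 1 := by
        obtain ⟨l, -, h4, h5⟩ := hI i 0
        by_contra h
        exact h2 l (by omega) h5
      calc v i k * c ^ (B - 1) ≤ C * c ^ (B - 1) := by
            rw [h1]
            gcongr
            exact hv0 i
        _ = c ^ (B - 1) * C := mul_comm _ _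
        _ ≤ c ^ k * (C + S k) :=
            mul_le_mul (pow_le_pow_of_le_one hc.le hc1 hk) (le_add_of_nonneg_right (hS0 k)) hC
              (by positivity)
    · have hkl : k ≤ l + B := by
        obtain ⟨l', h4, h5, h6⟩ := hI i (l + 1)
        by_contra h
        exact hlast l' (by omega) (by omega) h6
      have hCS : 0 ≤ C + S l := add_nonneg hC (hS0 l)
      -- An entry read at time `l` may be B₂ old, which costs c^(-B₂), besides the factor c^(-(B-1))
      -- of the induction hypothesis.
      have hV : ∀ j m, m ≤ l → l ≤ m + B₂ →
          v j m ≤ c ^ l * (C + S l) / (c ^ B₂ * c ^ (B - 1)) := by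
        intro j m hm hlm
        rw [le_div_iff₀ (by positivity)]
        calc v j m * (c ^ B₂ * c ^ (B - 1)) = c ^ B₂ * (v j m * c ^ (B - 1)) := by ring
          _ ≤ c ^ B₂ * (c ^ m * (C + S m)) :=
              mul_le_mul_of_nonneg_left (ih m (by omega) j) (by positivity)
          _ = c ^ (m + B₂) * (C + S m) := by ring
          _ ≤ c ^ l * (C + S l) :=
              mul_le_mul (pow_le_pow_of_le_one hc.le hc1 hlm)
                (add_le_add_right (hSmono hm) C) (add_nonneg hC (hS0 m)) (by positivity)
      have h1 := hupd l i hil _ hV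
      have h2 : c ^ (B * (n₀ + 1)) * (c ^ l * (C + S l) / (c ^ B₂ * c ^ (B - 1))) ≤
          c ^ (l + 1) * (C + S l) := by
        rw [← mul_div_assoc, div_le_iff₀ (by positivity)]
        -- The contraction is spent on delay, idle time and one step of progress: B₂ + (B-1) + 1 ≤
        -- B(n₀+1).
        have h3 : c ^ (B * (n₀ + 1)) ≤ c ^ (B₂ + (B - 1) + 1) :=
          pow_le_pow_of_le_one hc.le hc1 (by rw [Nat.mul_succ]; omega)
        calc c ^ (B * (n₀ + 1)) * (c ^ l * (C + S l))
            ≤ c ^ (B₂ + (B - 1) + 1) * (c ^ l * (C + S l)) := by gcongr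
          _ = c ^ (l + 1) * (C + S l) * (c ^ B₂ * c ^ (B - 1)) := by ring
      have h3 : v i (l + 1) ≤ c ^ (l + 1) * (C + S (l + 1)) := by
        have h4 : S (l + 1) = S l + e l / c ^ (l + 1) := Finset.sum_range_succ _ _
        have h5 : c ^ (l + 1) * (e l / c ^ (l + 1)) = e l :=
          mul_div_cancel₀ _ (by positivity)
        rw [h4, ← add_assoc, mul_add, h5]
        linarith
      rw [hv]
      calc v i (l + 1) * c ^ (B - 1) ≤ c ^ (l + 1) * (C + S (l + 1)) * c ^ (B - 1) := by gcongr
        _ = c ^ (l + 1 + (B - 1)) * (C + S (l + 1)) := by ring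
        _ ≤ c ^ k * (C + S k) :=
            mul_le_mul (pow_le_pow_of_le_one hc.le hc1 (by omega))
              (add_le_add_right (hSmono hlk) C) (add_nonneg hC (hS0 _)) (by positivity)

/-- Makes the tolerance at time `k` at most c^(k+1): a player updating at time `k` has done so more
than k/B times, so `B` times its count is at least k+1. -/
theorem pow_updateCount_le {n₀ : ℕ} {c : ℝ} (hc : 0 < c) (hc1 : c ≤ 1) (hB : 0 < B)
    (hI : UpdatesWithin I B) {i : Fin N} {k : ℕ} (hi : i ∈ I k) :
    (c ^ (B * (n₀ + 1))) ^ updateCount I i k ≤ c ^ (k + 1) := by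
  rw [← pow_mul]
  refine pow_le_pow_of_le_one hc.le hc1 ?_
  have h1 := div_lt_updateCount hI hi
  have h2 : k + 1 ≤ B * (k / B + 1) := by
    have := Nat.div_add_mod k B
    have := Nat.mod_lt k hB
    rw [Nat.mul_succ]
    omega
  calc k + 1 ≤ B * (k / B + 1) := h2
    _ ≤ B * (n₀ + 1) * updateCount I i k :=
        Nat.mul_le_mul (Nat.le_mul_of_pos_right _ (Nat.succ_pos _)) h1

end Updates

/-! ### Mean distance to equilibrium along a run. -/

section Convergence

variable {N : ℕ} {n : Fin N → ℕ} {d : ℕ} {G : StochGame n d} {M : Fin N → ℝ}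
  {Ω : Type*} {μ : ℝ} {I : ℕ → Finset (Fin N)} {B₂ : ℕ}
  {J : Fin N → ℕ → ℕ} {x : ℕ → Ω → Profile n}
  {τ : Fin N → Fin N → ℕ → Ω → ℕ} {ξ : Fin N → ℕ → ℕ → Ω → Noise d}
  [mΩ : MeasurableSpace Ω] {P : Measure Ω} {xstar : Profile n} {α : Fin N → ℕ → ℝ}

namespace IsAsyncRun

theorem norm_succ_sub_le (hG : G.Regular M) (hdd : G.DiagDominant) (hμ : 0 < μ)
    (hstar : G.IsNash xstar) (hrun : IsAsyncRun G μ M I B₂ J P x τ ξ) (i : Fin N) (k : ℕ)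
    (ω : Ω) :
    ‖x (k + 1) ω i - xstar i‖ ≤ ‖x (k + 1) ω i - G.proxBR μ i (delayed x τ i k ω)‖ +
      ∑ j, G.Gam μ i j * ‖delayed x τ i k ω j - xstar j‖ :=
  (norm_sub_le_norm_sub_add_norm_sub _ _ _).trans
    (add_le_add_right (hG.norm_proxBR_sub_nash_le hdd hμ hstar (hrun.delayed_mem hG i k ω) i) _)

variable [IsProbabilityMeasure P]

theorem integrable_norm_sub (hG : G.Regular M) (hstar : G.IsNash xstar)
    (hrun : IsAsyncRun G μ M I B₂ J P x τ ξ) (i : Fin N) (k : ℕ) :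
    Integrable (fun ω => ‖x k ω i - xstar i‖) P :=
  Integrable.of_bound (C := Metric.diam (G.X i))
    ((measurable_strategy (hrun.measurable_iterate hG k) i).sub_const _).norm.aestronglyMeasurable
    (Eventually.of_forall fun ω => by
      rw [norm_norm]
      exact hG.dist_le_diam (hrun.mem_joint hG k ω i) (hstar.1 i))

theorem integrable_norm_delayed_sub (hG : G.Regular M) (hstar : G.IsNash xstar)
    (hrun : IsAsyncRun G μ M I B₂ J P x τ ξ) (i j : Fin N) (k : ℕ) :
    Integrable (fun ω => ‖delayed x τ i k ω j - xstar j‖) P :=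
  Integrable.of_bound (C := Metric.diam (G.X j))
    ((measurable_strategy (measurable_delayed (fun l _ => hrun.measurable_iterate hG l)
      fun j => hrun.delay_meas i j k) j).sub_const _).norm.aestronglyMeasurable
    (Eventually.of_forall fun ω => by
      rw [norm_norm]
      exact hG.dist_le_diam (hrun.delayed_mem hG i k ω j) (hstar.1 j))

theorem integrable_norm_sub_proxBR (hG : G.Regular M) (hdd : G.DiagDominant) (hμ : 0 < μ)
    (hrun : IsAsyncRun G μ M I B₂ J P x τ ξ) {i : Fin N} {k : ℕ} (hi : i ∈ I k) :
    Integrable (fun ω => ‖x (k + 1) ω i - G.proxBR μ i (delayed x τ i k ω)‖) P :=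
  Integrable.of_bound (C := Metric.diam (G.X i))
    ((measurable_strategy (hrun.measurable_iterate hG (k + 1)) i).sub
      (hrun.measurable_proxBR_delayed hG hdd hμ hi)).norm.aestronglyMeasurable
    (Eventually.of_forall fun ω => by
      rw [norm_norm]
      exact hG.dist_le_diam (hrun.mem_joint hG (k + 1) ω i)
        (hG.proxBR_spec μ (hrun.delayed_mem hG i k ω) i).1)

/-- Independent delays do not increase the largest mean distance over the delay window. -/
theorem integral_norm_delayed_sub_le (hG : G.Regular M) (hstar : G.IsNash xstar)
    (hrun : IsAsyncRun G μ M I B₂ J P x τ ξ) (hind : DelaysIndep I P x τ) {i : Fin N} {k : ℕ}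
    (hi : i ∈ I k) (j : Fin N) {V : ℝ}
    (hV : ∀ m, m ≤ k → k ≤ m + B₂ → ∫ ω, ‖x m ω j - xstar j‖ ∂P ≤ V) :
    ∫ ω, ‖delayed x τ i k ω j - xstar j‖ ∂P ≤ V := by
  -- The delayed distance is split according to the value of the delay. Independence factors each
  -- expectation, so its mean is a convex combination of means over the window; values above B₂ have
  -- probability zero.
  set χ : ℕ → ℕ → ℝ := fun m => Set.indicator {m} 1 with hχ
  have hχm : ∀ m, Measurable (χ m) := fun m => measurable_of_countable _
  have hχi : ∀ m, Integrable (fun ω => χ m (τ i j k ω)) P := fun m =>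
    Integrable.of_bound (C := 1) ((hχm m).comp (hrun.delay_meas i j k)).aestronglyMeasurable
      (Eventually.of_forall fun ω => by
        by_cases h : τ i j k ω = m <;> simp [hχ, h])
  have hprod : ∀ m, ∫ ω, χ m (τ i j k ω) * ‖x (k - m) ω j - xstar j‖ ∂P =
      (∫ ω, χ m (τ i j k ω) ∂P) * ∫ ω, ‖x (k - m) ω j - xstar j‖ ∂P := by
    intro m
    have hψ : Measurable fun y : Fin (k + 1) → Profile n =>
        ‖y ⟨k - m, by omega⟩ j - xstar j‖ :=
      (((measurable_pi_apply j).comp (measurable_pi_apply _)).sub_const _).norm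
    exact ((hind k i hi j).comp (hχm m) hψ).integral_fun_mul_eq_mul_integral
      (hχi m).aestronglyMeasurable (hrun.integrable_norm_sub hG hstar j (k - m)).aestronglyMeasurable
  have hprodi : ∀ m, Integrable (fun ω => χ m (τ i j k ω) * ‖x (k - m) ω j - xstar j‖) P :=
    fun m => (hrun.integrable_norm_sub hG hstar j (k - m)).bdd_mul (c := 1)
      (hχi m).aestronglyMeasurable (Eventually.of_forall fun ω => by
        by_cases h : τ i j k ω = m <;> simp [hχ, h])
  have hsum : ∀ (g : ℕ → ℝ) ω, ∑ m ∈ Finset.range (k + 1), χ m (τ i j k ω) * g m =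
      g (τ i j k ω) := by
    intro g ω
    rw [Finset.sum_eq_single (τ i j k ω)]
    · simp [hχ]
    · intro m _ hm
      simp [hχ, hm.symm]
    · intro h
      exact absurd (Finset.mem_range.2 (Nat.lt_succ_of_le (hrun.delay_le i j k ω))) h
  have h1 : ∑ m ∈ Finset.range (k + 1), ∫ ω, χ m (τ i j k ω) ∂P = 1 := by
    rw [← integral_finsetSum _ fun m _ => hχi m]
    have : ∀ ω, ∑ m ∈ Finset.range (k + 1), χ m (τ i j k ω) = 1 := fun ω => by
      simpa using hsum (fun _ => 1) ω
    simp [this]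
  calc ∫ ω, ‖delayed x τ i k ω j - xstar j‖ ∂P
      = ∫ ω, ∑ m ∈ Finset.range (k + 1), χ m (τ i j k ω) * ‖x (k - m) ω j - xstar j‖ ∂P := by
        congr 1
        funext ω
        rw [hsum (fun m => ‖x (k - m) ω j - xstar j‖) ω]
        rfl
    _ = ∑ m ∈ Finset.range (k + 1),
          (∫ ω, χ m (τ i j k ω) ∂P) * ∫ ω, ‖x (k - m) ω j - xstar j‖ ∂P := by
        rw [integral_finsetSum _ fun m _ => hprodi m]
        exact Finset.sum_congr rfl fun m _ => hprod m
    _ ≤ ∑ m ∈ Finset.range (k + 1), (∫ ω, χ m (τ i j k ω) ∂P) * V := by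
        refine Finset.sum_le_sum fun m hm => ?_
        rw [Finset.mem_range] at hm
        by_cases hmB : m ≤ B₂
        · refine mul_le_mul_of_nonneg_left (hV (k - m) (by omega) (by omega)) ?_
          exact integral_nonneg fun ω => Set.indicator_nonneg (fun _ _ => zero_le_one) _
        · have h0 : ∫ ω, χ m (τ i j k ω) ∂P = 0 := by
            refine integral_eq_zero_of_ae ?_
            filter_upwards [hrun.delay_bdd k i hi j] with ω hω
            have : τ i j k ω ≠ m := by omega
            simp [hχ, this]
          simp [h0]
    _ = V := by rw [← Finset.sum_mul, h1, one_mul]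

/-- The recursion is applied to the means; errors c^(l+1) divided by c^(l+1) sum to `k`. -/
theorem integral_norm_sub_mul_le_of_indep {B n₀ : ℕ} {c C : ℝ} (hG : G.Regular M)
    (hdd : G.DiagDominant) (hμ : 0 < μ) (hstar : G.IsNash xstar)
    (hrun : IsAsyncRun G μ M I B₂ J P x τ ξ) (hind : DelaysIndep I P x τ)
    (hc : 0 < c) (hc1 : c ≤ 1) (hB : 0 < B) (hI : UpdatesWithin I B) (hB₂ : B₂ ≤ B * n₀)
    (hη : G.aInf μ = c ^ (B * (n₀ + 1))) (hα : IsInexactBR G μ I J α P x τ ξ)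
    (hα0 : ∀ k, ∀ i ∈ I k, 0 ≤ α i k ∧ α i k ≤ c ^ (k + 1))
    (hC : ∀ i, ∫ ω, ‖x 0 ω i - xstar i‖ ∂P ≤ C) (hC0 : 0 ≤ C) (k : ℕ) (i : Fin N) :
    (∫ ω, ‖x k ω i - xstar i‖ ∂P) * c ^ (B - 1) ≤ c ^ k * (C + k) := by
  have h := async_recursion_bound (B₂ := B₂) (n₀ := n₀) hc hc1 hB hI hB₂ hC0
    (e := fun k => c ^ (k + 1)) (fun l => by positivity)
    (v := fun i k => ∫ ω, ‖x k ω i - xstar i‖ ∂P) hC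
    (fun k i hi => by simp only [hrun.stay k i hi]) (fun k i hi V hV => ?_) k i
  · refine h.trans (le_of_eq ?_)
    congr 2
    rw [Finset.sum_congr rfl fun l _ => div_self (by positivity : c ^ (l + 1) ≠ 0)]
    simp
  · have hint1 := hrun.integrable_norm_sub_proxBR hG hdd hμ hi
    have hint2 : ∀ j ∈ Finset.univ, Integrable (fun ω =>
        G.Gam μ i j * ‖delayed x τ i k ω j - xstar j‖) P := fun j _ =>
      (hrun.integrable_norm_delayed_sub hG hstar i j k).const_mul _
    have hV0 : 0 ≤ V := (integral_nonneg fun ω => norm_nonneg _).trans (hV i k le_rfl (by omega))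
    calc ∫ ω, ‖x (k + 1) ω i - xstar i‖ ∂P
        ≤ ∫ ω, (‖x (k + 1) ω i - G.proxBR μ i (delayed x τ i k ω)‖ +
          ∑ j, G.Gam μ i j * ‖delayed x τ i k ω j - xstar j‖) ∂P :=
          integral_mono (hrun.integrable_norm_sub hG hstar i (k + 1))
            (hint1.add (integrable_finsetSum _ hint2))
            fun ω => hrun.norm_succ_sub_le hG hdd hμ hstar i k ω
      _ = ∫ ω, ‖x (k + 1) ω i - G.proxBR μ i (delayed x τ i k ω)‖ ∂P +
          ∑ j, G.Gam μ i j * ∫ ω, ‖delayed x τ i k ω j - xstar j‖ ∂P := by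
          rw [integral_add hint1 (integrable_finsetSum _ hint2), integral_finsetSum _ hint2]
          simp only [integral_const_mul]
      _ ≤ c ^ (k + 1) + ∑ j, G.Gam μ i j * V := by
          refine add_le_add ((hrun.integral_norm_sub_proxBR_le hG hdd hμ hα hi
            (hα0 k i hi).1).trans (hα0 k i hi).2) (Finset.sum_le_sum fun j _ => ?_)
          exact mul_le_mul_of_nonneg_left (hrun.integral_norm_delayed_sub_le hG hstar hind hi j
            fun m h1 h2 => hV j m h1 h2) (StochGame.Gam_nonneg hdd hμ i j)
      _ ≤ c ^ (k + 1) + c ^ (B * (n₀ + 1)) * V := by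
          rw [← Finset.sum_mul, ← hη]
          gcongr
          exact StochGame.sum_Gam_le_aInf hdd hμ i

/-- Without independence the means need not obey the recursion, since the delay may select a bad
iterate. It is therefore applied to each path, with the diameters as deterministic initial bound. A
pathwise error must serve all players at once, so it is the sum over the updating ones; its mean is
at most N c^(l+1), whence `N * k`. -/
theorem integral_norm_sub_mul_le {B n₀ : ℕ} {c : ℝ} (hG : G.Regular M)
    (hdd : G.DiagDominant) (hμ : 0 < μ) (hstar : G.IsNash xstar)
    (hrun : IsAsyncRun G μ M I B₂ J P x τ ξ)
    (hc : 0 < c) (hc1 : c ≤ 1) (hB : 0 < B) (hI : UpdatesWithin I B) (hB₂ : B₂ ≤ B * n₀)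
    (hη : G.aInf μ = c ^ (B * (n₀ + 1))) (hα : IsInexactBR G μ I J α P x τ ξ)
    (hα0 : ∀ k, ∀ i ∈ I k, 0 ≤ α i k ∧ α i k ≤ c ^ (k + 1)) (k : ℕ) (i : Fin N) :
    (∫ ω, ‖x k ω i - xstar i‖ ∂P) * c ^ (B - 1) ≤
      c ^ k * (∑ j, Metric.diam (G.X j) + N * k) := by
  set e : ℕ → Ω → ℝ := fun k ω =>
    ∑ i ∈ I k, ‖x (k + 1) ω i - G.proxBR μ i (delayed x τ i k ω)‖ with he
  have hei : ∀ l, Integrable (e l) P := fun l =>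
    integrable_finsetSum _ fun i hi => hrun.integrable_norm_sub_proxBR hG hdd hμ hi
  have hpath : ∀ᵐ ω ∂P, ‖x k ω i - xstar i‖ * c ^ (B - 1) ≤
      c ^ k * (∑ j, Metric.diam (G.X j) + ∑ l ∈ Finset.range k, e l ω / c ^ (l + 1)) := by
    have hdelay : ∀ᵐ ω ∂P, ∀ k, ∀ i ∈ I k, ∀ j, τ i j k ω ≤ B₂ :=
      ae_all_iff.2 fun k => ae_all_iff.2 fun i => ae_all_iff.2 fun hi => ae_all_iff.2 fun j =>
        hrun.delay_bdd k i hi j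
    filter_upwards [hdelay] with ω hω
    refine async_recursion_bound (B₂ := B₂) (n₀ := n₀) hc hc1 hB hI hB₂
      (Finset.sum_nonneg fun j _ => Metric.diam_nonneg) (e := fun l => e l ω)
      (fun l => Finset.sum_nonneg fun i _ => norm_nonneg _)
      (v := fun i k => ‖x k ω i - xstar i‖) (fun i => ?_)
      (fun k i hi => by simp only [hrun.stay k i hi]) (fun k i hi V hV => ?_) k i
    · exact (hG.dist_le_diam (hrun.mem_joint hG 0 ω i) (hstar.1 i)).trans
        (Finset.single_le_sum (f := fun j => Metric.diam (G.X j))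
          (fun j _ => Metric.diam_nonneg) (Finset.mem_univ i))
    · have hV0 : 0 ≤ V := (norm_nonneg _).trans (hV i k le_rfl (by omega))
      refine (hrun.norm_succ_sub_le hG hdd hμ hstar i k ω).trans (add_le_add ?_ ?_)
      · exact Finset.single_le_sum
          (f := fun i => ‖x (k + 1) ω i - G.proxBR μ i (delayed x τ i k ω)‖)
          (fun j _ => norm_nonneg _) hi
      · calc ∑ j, G.Gam μ i j * ‖delayed x τ i k ω j - xstar j‖ ≤ ∑ j, G.Gam μ i j * V := by
              refine Finset.sum_le_sum fun j _ => mul_le_mul_of_nonneg_left ?_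
                (StochGame.Gam_nonneg hdd hμ i j)
              have h1 := hω k i hi j
              have h2 := hrun.delay_le i j k ω
              exact hV j (k - τ i j k ω) (by omega) (by omega)
          _ ≤ c ^ (B * (n₀ + 1)) * V := by
              rw [← Finset.sum_mul, ← hη]
              gcongr
              exact StochGame.sum_Gam_le_aInf hdd hμ i
  have hei' : ∀ l ∈ Finset.range k, Integrable (fun ω => e l ω / c ^ (l + 1)) P :=
    fun l _ => (hei l).div_const _
  have hint := integral_mono_ae ((hrun.integrable_norm_sub hG hstar i k).mul_const _)
    (((integrable_const (∑ j, Metric.diam (G.X j))).add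
      (integrable_finsetSum _ hei')).const_mul (c ^ k)) hpath
  rw [integral_mul_const, integral_const_mul] at hint
  refine hint.trans (mul_le_mul_of_nonneg_left ?_ (by positivity))
  have e1 := integral_add (μ := P) (integrable_const (∑ j, Metric.diam (G.X j)))
    (integrable_finsetSum _ hei')
  refine e1.le.trans ?_
  rw [integral_finsetSum _ hei']
  refine add_le_add (by simp) ?_
  have h2 : ∀ l ∈ Finset.range k, ∫ ω, e l ω / c ^ (l + 1) ∂P ≤ N := by
    intro l _
    rw [integral_div, div_le_iff₀ (by positivity), integral_finsetSum _
      fun i hi => hrun.integrable_norm_sub_proxBR hG hdd hμ hi]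
    calc _ ≤ ∑ i ∈ I l, c ^ (l + 1) := Finset.sum_le_sum fun i hi =>
          (hrun.integral_norm_sub_proxBR_le hG hdd hμ hα hi (hα0 l i hi).1).trans (hα0 l i hi).2
      _ = (I l).card * c ^ (l + 1) := by simp
      _ ≤ N * c ^ (l + 1) := by
          gcongr
          exact_mod_cast (Finset.card_le_univ (I l)).trans (by simp)
  refine (Finset.sum_le_sum h2).trans (le_of_eq ?_)
  simp [mul_comm]

end IsAsyncRun

end Convergence

/-! ### The rate q, the constant D and elementary growth estimates. -/

section Rates

/-- The rate `q` for which `D = 1 / ln ((q / c) ^ e)`, where `c = η ^ (1 / p)`. -/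
theorem exists_rate {η p δ c D : ℝ} (h0 : 0 < η) (h1 : η < 1) (hp : 0 < p) (hδ : 0 < δ)
    (hc : c = η ^ (1 / p))
    (hD : D = (p + 2 * p ^ 2 * δ⁻¹) / (Real.exp 1 * Real.log η⁻¹)) :
    0 < D ∧ ∃ q : ℝ, c < q ∧ q < 1 ∧ D = 1 / Real.log ((q / c) ^ Real.exp 1) ∧
      Real.log (1 / q) = 2 * Real.log η⁻¹ / (2 * p + δ) := by
  have hL : 0 < Real.log η⁻¹ := Real.log_pos ((one_lt_inv₀ h0).2 h1)
  have he := Real.exp_pos 1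
  set L := Real.log η⁻¹ with hLdef
  have hlogη : Real.log η = -L := by rw [hLdef, Real.log_inv, neg_neg]
  have hc0 : 0 < c := hc ▸ Real.rpow_pos_of_pos h0 _
  have hlogc : Real.log c = -(L / p) := by
    rw [hc, Real.log_rpow h0, hlogη]
    ring
  have hq : Real.log (Real.exp (-(2 * L / (2 * p + δ)))) = -(2 * L / (2 * p + δ)) :=
    Real.log_exp _
  have hdiff : -(2 * L / (2 * p + δ)) - -(L / p) = L * δ / (p * (2 * p + δ)) := by
    field_simp
    ring
  -- This q is forced by the exponent 2p+δ; it gives ln(q/c) = Lδ/(p(2p+δ)), and the reciprocal of e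
  -- times this is `D`.
  refine ⟨by rw [hD]; positivity, Real.exp (-(2 * L / (2 * p + δ))), ?_, ?_, ?_, ?_⟩
  · rw [← Real.log_lt_log_iff hc0 (Real.exp_pos _), hq, hlogc]
    have : 0 < L * δ / (p * (2 * p + δ)) := by positivity
    linarith
  · rw [Real.exp_lt_one_iff, neg_lt_zero]
    positivity
  · rw [Real.log_rpow (by positivity), Real.log_div (Real.exp_pos _).ne' hc0.ne', hq, hlogc, hdiff,
      hD]
    field_simp
    ring
  · rw [one_div, Real.log_inv, hq, neg_neg]

/-- This is e x ≤ exp x at x = k ln(q/c). -/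
theorem mul_pow_le {c q D : ℝ} (hc : 0 < c) (hq : c < q)
    (hD : D = 1 / Real.log ((q / c) ^ Real.exp 1)) (k : ℕ) : k * c ^ k ≤ D * q ^ k := by
  have hq0 : 0 < q := hc.trans hq
  have hs : 0 < Real.log (q / c) := Real.log_pos ((one_lt_div hc).2 hq)
  set s := Real.log (q / c) with hsdef
  have h1 : (k : ℝ) * s * Real.exp 1 ≤ (q / c) ^ k := by
    have h2 := Real.add_one_le_exp ((k : ℝ) * s - 1)
    have h3 : (q / c) ^ k = Real.exp ((k : ℝ) * s - 1) * Real.exp 1 := by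
      rw [← Real.exp_add, sub_add_cancel, Real.exp_nat_mul, Real.exp_log (by positivity)]
    rw [h3]
    gcongr
    linarith
  rw [div_pow, le_div_iff₀ (by positivity)] at h1
  rw [hD, Real.log_rpow (by positivity), ← hsdef, one_div, inv_mul_eq_div,
    le_div_iff₀ (by positivity)]
  linarith

theorem rate_pow_ceil_le {q t : ℝ} (hq0 : 0 < q) (hq1 : q < 1) (ht : 0 < t) :
    q ^ ⌈Real.log (1 / t) / Real.log (1 / q)⌉₊ ≤ t := by
  have hlq : 0 < Real.log (1 / q) := Real.log_pos ((one_lt_div hq0).2 hq1)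
  have h := Nat.le_ceil (Real.log (1 / t) / Real.log (1 / q))
  rw [div_le_iff₀ hlq, one_div, one_div, Real.log_inv, Real.log_inv] at h
  rw [← Real.log_le_log_iff (by positivity) ht, Real.log_pow]
  simp only [one_div, Real.log_inv] at h ⊢
  linarith

/-- The restriction to update times is dropped. The geometric sum is estimated by a - 1 ≥ ln a and
a^⌈X⌉ ≤ a·a^X; rounding up each `J k` costs the final `⌈X⌉₊`. For X ≤ 0 the sum is empty. -/
theorem sum_geometric_le {a W X : ℝ} (ha : 1 < a) (hW : 0 ≤ W) {J : ℕ → ℕ}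
    (hJ : ∀ k, (J k : ℝ) ≤ W * a ^ k + 1) (p : ℕ → Prop) [DecidablePred p] :
    ((∑ k ∈ (Finset.range ⌈X⌉₊).filter p, J k : ℕ) : ℝ) ≤
      W * a / Real.log a * a ^ X + ⌈X⌉₊ := by
  have ha0 : 0 < a := zero_lt_one.trans ha
  have hla : 0 < Real.log a := Real.log_pos ha
  have hmain : W * ∑ k ∈ Finset.range ⌈X⌉₊, a ^ k ≤ W * a / Real.log a * a ^ X := by
    rcases le_or_gt X 0 with hX | hX
    · rw [Nat.ceil_eq_zero.2 hX]
      simp only [Finset.range_zero, Finset.sum_empty, mul_zero]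
      positivity
    · rw [geom_sum_eq ha.ne', mul_div_assoc, mul_assoc]
      refine mul_le_mul_of_nonneg_left ?_ hW
      have h1 : Real.log a ≤ a - 1 := Real.log_le_sub_one_of_pos ha0
      have h2 : a ^ ⌈X⌉₊ ≤ a * a ^ X := by
        rw [← Real.rpow_natCast, mul_comm, ← Real.rpow_add_one ha0.ne']
        exact Real.rpow_le_rpow_of_exponent_le ha.le (Nat.ceil_lt_add_one hX.le).le
      calc (a ^ ⌈X⌉₊ - 1) / (a - 1) ≤ a * a ^ X / Real.log a := by
            gcongr
            linarith
        _ = a / Real.log a * a ^ X := by ring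
  calc ((∑ k ∈ (Finset.range ⌈X⌉₊).filter p, J k : ℕ) : ℝ)
      ≤ ((∑ k ∈ Finset.range ⌈X⌉₊, J k : ℕ) : ℝ) := by
        exact_mod_cast Finset.sum_le_sum_of_subset (Finset.filter_subset _ _)
    _ ≤ ∑ k ∈ Finset.range ⌈X⌉₊, (W * a ^ k + 1) := by
        push_cast
        exact Finset.sum_le_sum fun k _ => hJ k
    _ = W * ∑ k ∈ Finset.range ⌈X⌉₊, a ^ k + ⌈X⌉₊ := by
        rw [Finset.sum_add_distrib, ← Finset.mul_sum]
        simp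
    _ ≤ _ := by gcongr

theorem rpow_log_div_log {a t q : ℝ} (ha : 0 < a) (ht : 0 < t) :
    a ^ (Real.log t / Real.log q) = t ^ (Real.log a / Real.log q) := by
  rw [Real.rpow_def_of_pos ha, Real.rpow_def_of_pos ht]
  congr 1
  ring

/-- The logarithm is absorbed by ln z ≤ z^p/p, and constants by (1/ε)^p ≥ 1, which needs ε ≤ 1. -/
theorem exists_mul_rpow_bound {W T p a : ℝ} (hW : 0 ≤ W) (hT : 0 < T) (hp : 0 < p) (ha : 0 ≤ a) :
    ∃ A : ℝ, 0 ≤ A ∧ ∀ ε : ℝ, 0 < ε → ε ≤ 1 →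
      W * (T / ε) ^ p + ⌈Real.log (T / ε) * a⌉₊ ≤ A * (1 / ε) ^ p := by
  refine ⟨W * T ^ p + (|Real.log T| * a + a / p + 1), by positivity, fun ε h0 h1 => ?_⟩
  have hinv : 1 ≤ 1 / ε := (one_le_div h0).2 h1
  have hz : 1 ≤ (1 / ε) ^ p := Real.one_le_rpow hinv hp.le
  have hlog : Real.log (1 / ε) ≤ (1 / ε) ^ p / p := Real.log_le_rpow_div (by positivity) hp
  have hlog0 : 0 ≤ Real.log (1 / ε) := Real.log_nonneg hinv
  have hsplit : Real.log (T / ε) = Real.log T + Real.log (1 / ε) := by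
    rw [← Real.log_mul hT.ne' (by positivity), mul_one_div]
  have hceil : (⌈Real.log (T / ε) * a⌉₊ : ℝ) ≤ (|Real.log T| + Real.log (1 / ε)) * a + 1 := by
    refine (Nat.cast_le.2 (Nat.ceil_mono (?_ : _ ≤ (|Real.log T| + Real.log (1 / ε)) * a))).trans
      (Nat.ceil_lt_add_one (by positivity)).le
    rw [hsplit]
    gcongr
    exact le_abs_self _
  have hpow : (T / ε) ^ p = T ^ p * (1 / ε) ^ p := by
    rw [← Real.mul_rpow hT.le (by positivity), mul_one_div]
  have h2 : Real.log (1 / ε) * a ≤ a / p * (1 / ε) ^ p := by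
    calc Real.log (1 / ε) * a ≤ (1 / ε) ^ p / p * a := by gcongr
      _ = a / p * (1 / ε) ^ p := by ring
  have h3 : |Real.log T| * a ≤ |Real.log T| * a * (1 / ε) ^ p :=
    le_mul_of_one_le_right (by positivity) hz
  rw [hpow]
  nlinarith

theorem isBigO_of_bound_unit {f : ℝ → ℝ} {A p : ℝ} (hf : ∀ ε, 0 < ε → 0 ≤ f ε)
    (h : ∀ ε : ℝ, 0 < ε → ε ≤ 1 → f ε ≤ A * (1 / ε) ^ p) :
    f =O[𝓝[>] 0] fun ε : ℝ => (1 / ε) ^ p := by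
  refine IsBigO.of_bound A ?_
  filter_upwards [Ioc_mem_nhdsGT (zero_lt_one (α := ℝ))] with ε hε
  rw [Real.norm_of_nonneg (hf ε hε.1),
    Real.norm_of_nonneg (Real.rpow_nonneg (one_div_nonneg.2 hε.1.le) _)]
  exact h ε hε.1 hε.2

variable {ρ c C D q ε : ℝ} {B : ℕ}

theorem epsHat_pos (hρ : 0 < ρ) (hCD : 0 < C + D) (hε : 0 < ε) : 0 < epsHat ρ C D B ε :=
  mul_pos (div_pos hε hCD) (Real.rpow_pos_of_pos hρ _)

theorem one_div_epsHat (ρ C D : ℝ) (B : ℕ) (ε : ℝ) :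
    1 / epsHat ρ C D B ε = (C + D) / ρ ^ (((B : ℝ) - 1) / B) / ε := by
  rw [epsHat, ← mul_div_right_comm, one_div_div, div_div, mul_comm ε]

theorem epsHat_eq (hρ : 0 ≤ ρ) (hB : 0 < B) (hc : c = ρ ^ (1 / (B : ℝ))) :
    epsHat ρ C D B ε = ε / (C + D) * c ^ (B - 1) := by
  rw [epsHat, hc, ← Real.rpow_mul_natCast hρ, Nat.cast_pred hB, one_div_mul_eq_div]

/-- The number of major iterations suffices for accuracy `ε`. -/
theorem le_of_mul_pow_le (hρ : 0 < ρ) (hB : 0 < B) (hc : c = ρ ^ (1 / (B : ℝ))) (hq : c < q)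
    (hq1 : q < 1) (hD : D = 1 / Real.log ((q / c) ^ Real.exp 1)) (hε : 0 < ε) (hCD : 0 < C + D)
    {a b v : ℝ} (ha : 0 ≤ a) (hb : 0 ≤ b) (hab : a + b * D ≤ C + D)
    (hv : v * c ^ (B - 1) ≤ c ^ majorIters ρ C D q B ε * (a + b * majorIters ρ C D q B ε)) :
    v ≤ ε := by
  have hc0 : 0 < c := hc ▸ Real.rpow_pos_of_pos hρ _
  have hK := rate_pow_ceil_le (hc0.trans hq) hq1 (epsHat_pos (B := B) hρ hCD hε)
  rw [← majorIters] at hK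
  set K := majorIters ρ C D q B ε
  have h1 := mul_pow_le hc0 hq hD K
  have h2 : c ^ K ≤ q ^ K := pow_le_pow_left₀ hc0.le hq.le K
  have h3 : v * c ^ (B - 1) ≤ ε * c ^ (B - 1) := by
    -- The weights `a`, `b` cover both kinds of delays: `C` and 1 for independent ones, the sum of
    -- the diameters and `N` for arbitrary ones.
    calc v * c ^ (B - 1) ≤ c ^ K * (a + b * K) := hv
      _ = a * c ^ K + b * (K * c ^ K) := by ring
      _ ≤ a * q ^ K + b * (D * q ^ K) := by gcongr
      _ = q ^ K * (a + b * D) := by ring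
      _ ≤ epsHat ρ C D B ε * (C + D) := by
          have := pow_pos (hc0.trans hq) K
          calc q ^ K * (a + b * D) ≤ q ^ K * (C + D) := by gcongr
            _ ≤ _ := by gcongr
      _ = ε * c ^ (B - 1) := by
          rw [epsHat_eq hρ.le hB hc]
          field_simp
  exact le_of_mul_le_mul_right h3 (by positivity)

end Rates

/-! ### Sizes of the inner step numbers. -/

section StepNumbers

variable {N : ℕ} {Q : Fin N → ℝ} {η : ℝ} {I : ℕ → Finset (Fin N)}

theorem stepsAsync_le (hQ : ∀ i, 0 ≤ Q i) (hη : 0 < η) (i : Fin N) (k : ℕ) :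
    (stepsAsync Q η i k : ℝ) ≤ Q i / η ^ 2 * (1 / η ^ 2) ^ k + 1 := by
  have h : Q i / η ^ (2 * (k + 1)) = Q i / η ^ 2 * (1 / η ^ 2) ^ k := by
    rw [Nat.mul_succ, pow_add, pow_mul, one_div, inv_pow]
    field_simp
  rw [stepsAsync, h]
  have := hQ i
  exact (Nat.ceil_lt_add_one (by positivity)).le

theorem stepsCyclic_le (hQ : ∀ i, 0 ≤ Q i) (hη : 0 < η) (i : Fin N) (k : ℕ) :
    (stepsCyclic Q η i k : ℝ) ≤ Q i / η ^ 2 * (1 / (η ^ (1 / (N : ℝ))) ^ 2) ^ k + 1 := by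
  have h : Q i / η ^ (2 + 2 * (k : ℝ) / N) =
      Q i / η ^ 2 * (1 / (η ^ (1 / (N : ℝ))) ^ 2) ^ k := by
    rw [Real.rpow_add hη, Real.rpow_two, one_div, inv_pow, ← pow_mul, ← Real.rpow_mul_natCast hη.le,
      ← div_div, div_eq_mul_inv (Q i / η ^ 2)]
    congr 3
    push_cast
    ring
  rw [stepsCyclic, h]
  have := hQ i
  exact (Nat.ceil_lt_add_one (by positivity)).le

theorem le_stepsAsync (hη : 0 < η) (hη1 : η ≤ 1) (i : Fin N) (k : ℕ) :
    Q i ≤ (η ^ updateCount I i k) ^ 2 * stepsAsync Q η i k := by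
  have h1 : Q i / η ^ (2 * (k + 1)) ≤ stepsAsync Q η i k := Nat.le_ceil _
  rw [div_le_iff₀ (by positivity)] at h1
  refine h1.trans ?_
  rw [mul_comm, ← pow_mul]
  refine mul_le_mul_of_nonneg_right (pow_le_pow_of_le_one hη.le hη1 ?_) (Nat.cast_nonneg _)
  have := updateCount_le I i k
  omega

/-- The cyclic order allows at most k/N + 1 updates by time `k`, so an exponent growing like 2k/N
instead of 2k already meets the tolerance; this removes a factor `N` from the final exponent. -/
theorem le_stepsCyclic [NeZero N] (hI : UpdatesCyclically I) (hη : 0 < η) (hη1 : η ≤ 1)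
    (i : Fin N) (k : ℕ) :
    Q i ≤ (η ^ updateCount I i k) ^ 2 * stepsCyclic Q η i k := by
  have h1 : Q i / η ^ (2 + 2 * (k : ℝ) / N) ≤ stepsCyclic Q η i k := Nat.le_ceil _
  have hpos : 0 < η ^ (2 + 2 * (k : ℝ) / N) := Real.rpow_pos_of_pos hη _
  rw [div_le_iff₀ hpos] at h1
  refine h1.trans ?_
  rw [mul_comm, ← pow_mul, ← Real.rpow_natCast η]
  refine mul_le_mul_of_nonneg_right (Real.rpow_le_rpow_of_exponent_ge hη hη1 ?_)
    (Nat.cast_nonneg _)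
  have h2 : (updateCount I i k : ℝ) ≤ (k / N : ℕ) + 1 := by exact_mod_cast hI.updateCount_le i k
  have h3 : ((k / N : ℕ) : ℝ) ≤ (k : ℝ) / N := Nat.cast_div_le
  push_cast
  rw [mul_div_assoc]
  linarith

end StepNumbers

/-! ### Evaluation of ℓ⁽¹⁾ and ℓ⁽²⁾ and comparison with the step counts. -/

section Complexity

variable {N : ℕ} {Q η ρ c C D q p δ ε : ℝ} {B n₀ : ℕ}

theorem log_one_div_sq (η : ℝ) : Real.log (1 / η ^ 2) = 2 * Real.log η⁻¹ := by
  rw [one_div, ← inv_pow, Real.log_pow]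
  norm_num

theorem log_one_div_rpow_sq (h0 : 0 < η) (N : ℕ) :
    Real.log (1 / (η ^ (1 / (N : ℝ))) ^ 2) = 2 * Real.log η⁻¹ / N := by
  rw [log_one_div_sq, Real.log_inv, Real.log_rpow h0, Real.log_inv]
  ring

theorem rate_eq_rpow (h0 : 0 < η) (hρ : ρ = η ^ (1 / ((n₀ : ℝ) + 1)))
    (hc : c = ρ ^ (1 / (B : ℝ))) : c = η ^ (1 / ((B : ℝ) * (1 + n₀))) := by
  rw [hc, hρ, ← Real.rpow_mul h0.le, one_div_mul_one_div, add_comm (n₀ : ℝ), mul_comm (B : ℝ)]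

theorem eq_rate_pow (h0 : 0 < η) (hB : 0 < B) (hρ : ρ = η ^ (1 / ((n₀ : ℝ) + 1)))
    (hc : c = ρ ^ (1 / (B : ℝ))) : η = c ^ (B * (n₀ + 1)) := by
  rw [rate_eq_rpow h0 hρ hc, ← Real.rpow_mul_natCast h0.le]
  have : (1 / ((B : ℝ) * (1 + n₀))) * ((B * (n₀ + 1) : ℕ) : ℝ) = 1 := by
    push_cast
    field_simp
    ring
  rw [this, Real.rpow_one]

theorem epsHat_eq_rpow (h0 : 0 < η) (hρ : ρ = η ^ (1 / ((n₀ : ℝ) + 1))) :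
    epsHat ρ C D B ε = ε / (C + D) * η ^ (((B : ℝ) - 1) / (B * ((n₀ : ℝ) + 1))) := by
  rw [epsHat, hρ, ← Real.rpow_mul h0.le]
  congr 2
  rw [one_div_mul_eq_div, div_div]

theorem ell₁_eq (h0 : 0 < η) (h1 : η < 1) (hp : 0 < p) (hδ : 0 < δ)
    (hq : Real.log (1 / q) = 2 * Real.log η⁻¹ / (2 * p + δ)) :
    ell₁ Q η ρ C D q B ε = Q / (η ^ 4 * Real.log (1 / η ^ 2)) *
      (1 / epsHat ρ C D B ε) ^ (2 * p + δ) +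
      ⌈Real.log (1 / epsHat ρ C D B ε) * ((2 * p + δ) / (2 * Real.log η⁻¹))⌉₊ := by
  have hL : 0 < Real.log η⁻¹ := Real.log_pos ((one_lt_inv₀ h0).2 h1)
  have e : Real.log (1 / η ^ 2) / Real.log (1 / q) = 2 * p + δ := by
    rw [hq, log_one_div_sq]
    generalize Real.log η⁻¹ = L at hL
    field_simp
  rw [ell₁, majorIters, e, hq, div_div_eq_mul_div, mul_div_assoc]

/-- The rate is taken with parameters N p and N δ; the `N` cancels against the one in ln(1/η̃²) = 2
ln(1/η)/N, leaving the exponent 2p+δ. -/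
theorem ell₂_eq [NeZero N] (h0 : 0 < η) (h1 : η < 1) (hp : 0 < p) (hδ : 0 < δ)
    (hq : Real.log (1 / q) = 2 * Real.log η⁻¹ / (2 * (N * p) + N * δ)) :
    ell₂ Q η ρ C D q N ε =
      Q / (η ^ (2 + 2 / (N : ℝ)) * Real.log (1 / η ^ (2 / (N : ℝ)))) *
        (1 / epsHat ρ C D N ε) ^ (2 * p + δ) +
      ⌈Real.log (1 / epsHat ρ C D N ε) * ((2 * p + δ) / (2 * Real.log η⁻¹ / N))⌉₊ := by
  have hL : 0 < Real.log η⁻¹ := Real.log_pos ((one_lt_inv₀ h0).2 h1)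
  have hN : (0 : ℝ) < N := Nat.cast_pos.2 (NeZero.pos N)
  have hq' : Real.log (1 / q) = 2 * Real.log η⁻¹ / N / (2 * p + δ) := by
    rw [hq, div_div]
    congr 1
    ring
  have hsq : (η ^ (1 / (N : ℝ))) ^ 2 = η ^ (2 / (N : ℝ)) := by
    rw [← Real.rpow_mul_natCast h0.le]
    congr 1
    push_cast
    ring
  have e : Real.log (1 / (η ^ (1 / (N : ℝ))) ^ 2) / Real.log (1 / q) = 2 * p + δ := by
    rw [hq', log_one_div_rpow_sq h0]
    generalize Real.log η⁻¹ = L at hL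
    field_simp
  have e2 : (η ^ (1 / (N : ℝ))) ^ 2 * η ^ 2 = η ^ (2 + 2 / (N : ℝ)) := by
    rw [hsq, mul_comm, Real.rpow_add h0, Real.rpow_two]
  rw [ell₂, majorIters, e, e2, hsq, hq', div_div_eq_mul_div, mul_div_assoc]

theorem majorIters_rpow {a : ℝ} (ha : 0 < a) (hρ : 0 < ρ) (hCD : 0 < C + D) (hε : 0 < ε) :
    a ^ (Real.log (1 / epsHat ρ C D B ε) / Real.log (1 / q)) =
      (1 / epsHat ρ C D B ε) ^ (Real.log a / Real.log (1 / q)) :=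
  rpow_log_div_log ha (one_div_pos.2 (epsHat_pos hρ hCD hε))

theorem ell₁_nonneg (hQ : 0 ≤ Q) (h0 : 0 < η) (h1 : η < 1) (hρ : 0 < ρ) (hCD : 0 < C + D)
    (hε : 0 < ε) : 0 ≤ ell₁ Q η ρ C D q B ε := by
  have hL : 0 < Real.log η⁻¹ := Real.log_pos ((one_lt_inv₀ h0).2 h1)
  have := epsHat_pos (B := B) hρ hCD hε
  rw [ell₁, log_one_div_sq]
  positivity

theorem ell₂_nonneg (hQ : 0 ≤ Q) (h0 : 0 < η) (h1 : η < 1) (hρ : 0 < ρ) (hCD : 0 < C + D)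
    (hε : 0 < ε) : 0 ≤ ell₂ Q η ρ C D q N ε := by
  have hL : 0 < Real.log η⁻¹ := Real.log_pos ((one_lt_inv₀ h0).2 h1)
  have := epsHat_pos (B := N) hρ hCD hε
  have := Real.rpow_pos_of_pos h0 (1 / (N : ℝ))
  rw [ell₂, log_one_div_rpow_sq h0]
  positivity

theorem exists_ell₁_bound (hQ : 0 ≤ Q) (h0 : 0 < η) (h1 : η < 1) (hρ : 0 < ρ) (hCD : 0 < C + D)
    (hp : 0 < p) (hδ : 0 < δ) (hq : Real.log (1 / q) = 2 * Real.log η⁻¹ / (2 * p + δ)) :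
    ∃ A : ℝ, 0 ≤ A ∧ ∀ ε : ℝ, 0 < ε → ε ≤ 1 →
      ell₁ Q η ρ C D q B ε ≤ A * (1 / ε) ^ (2 * p + δ) := by
  have hL : 0 < Real.log η⁻¹ := Real.log_pos ((one_lt_inv₀ h0).2 h1)
  have := Real.rpow_pos_of_pos hρ (((B : ℝ) - 1) / B)
  simp only [ell₁_eq h0 h1 hp hδ hq, one_div_epsHat]
  refine exists_mul_rpow_bound ?_ (by positivity) (by positivity) (by positivity)
  rw [log_one_div_sq]
  positivity

theorem exists_ell₂_bound [NeZero N] (hQ : 0 ≤ Q) (h0 : 0 < η) (h1 : η < 1) (hρ : 0 < ρ)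
    (hCD : 0 < C + D) (hp : 0 < p) (hδ : 0 < δ)
    (hq : Real.log (1 / q) = 2 * Real.log η⁻¹ / (2 * (N * p) + N * δ)) :
    ∃ A : ℝ, 0 ≤ A ∧ ∀ ε : ℝ, 0 < ε → ε ≤ 1 →
      ell₂ Q η ρ C D q N ε ≤ A * (1 / ε) ^ (2 * p + δ) := by
  have hL : 0 < Real.log η⁻¹ := Real.log_pos ((one_lt_inv₀ h0).2 h1)
  have hlog : Real.log (1 / η ^ (2 / (N : ℝ))) = 2 / N * Real.log η⁻¹ := by
    rw [one_div, Real.log_inv, Real.log_rpow h0, Real.log_inv]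
    ring
  have := Real.rpow_pos_of_pos hρ (((N : ℝ) - 1) / N)
  have := Real.rpow_pos_of_pos h0 (2 + 2 / (N : ℝ))
  simp only [ell₂_eq h0 h1 hp hδ hq, one_div_epsHat]
  refine exists_mul_rpow_bound ?_ (by positivity) (by positivity) (by positivity)
  rw [hlog]
  positivity

variable {Qf : Fin N → ℝ} {I : ℕ → Finset (Fin N)}

theorem totalSteps_stepsAsync_le (hQ : ∀ i, 0 ≤ Qf i) (h0 : 0 < η) (h1 : η < 1) (hρ : 0 < ρ)
    (hCD : 0 < C + D) (hε : 0 < ε) (i : Fin N) :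
    (totalSteps I (stepsAsync Qf η) i (majorIters ρ C D q B ε) : ℝ) ≤
      ell₁ (Qf i) η ρ C D q B ε := by
  have ha : 1 < 1 / η ^ 2 := by
    rw [one_lt_div (by positivity)]
    exact pow_lt_one₀ h0.le h1 two_ne_zero
  have h := sum_geometric_le (X := Real.log (1 / epsHat ρ C D B ε) / Real.log (1 / q)) ha
    (div_nonneg (hQ i) (by positivity : (0 : ℝ) ≤ η ^ 2)) (stepsAsync_le hQ h0 i) (fun k => i ∈ I k)
  rw [majorIters_rpow (by positivity) hρ hCD hε] at h
  refine h.trans (le_of_eq ?_)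
  rw [ell₁, majorIters]
  congr 2
  field_simp

theorem totalSteps_stepsCyclic_le [NeZero N] (hQ : ∀ i, 0 ≤ Qf i) (h0 : 0 < η) (h1 : η < 1)
    (hρ : 0 < ρ) (hCD : 0 < C + D) (hε : 0 < ε) (i : Fin N) :
    (totalSteps I (stepsCyclic Qf η) i (majorIters ρ C D q N ε) : ℝ) ≤
      ell₂ (Qf i) η ρ C D q N ε := by
  have hN : (0 : ℝ) < N := Nat.cast_pos.2 (NeZero.pos N)
  have hpos := Real.rpow_pos_of_pos h0 (1 / (N : ℝ))
  have ha : 1 < 1 / (η ^ (1 / (N : ℝ))) ^ 2 := by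
    rw [one_lt_div (by positivity)]
    exact pow_lt_one₀ hpos.le (Real.rpow_lt_one h0.le h1 (by positivity)) two_ne_zero
  have h := sum_geometric_le (X := Real.log (1 / epsHat ρ C D N ε) / Real.log (1 / q)) ha
    (div_nonneg (hQ i) (by positivity : (0 : ℝ) ≤ η ^ 2)) (stepsCyclic_le hQ h0 i) (fun k => i ∈ I k)
  rw [majorIters_rpow (by positivity) hρ hCD hε] at h
  refine h.trans (le_of_eq ?_)
  rw [ell₂, majorIters]
  congr 2
  field_simp

end Complexity

/-! ### Accuracy after the prescribed number of major iterations. -/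

section EpsNash

variable {N : ℕ} {n : Fin N → ℕ} {d : ℕ} {G : StochGame n d} {M : Fin N → ℝ}
  {Ω : Type*} {μ : ℝ} {I : ℕ → Finset (Fin N)} {B₂ B n₀ : ℕ}
  {J : Fin N → ℕ → ℕ} {x : ℕ → Ω → Profile n}
  {τ : Fin N → Fin N → ℕ → Ω → ℕ} {ξ : Fin N → ℕ → ℕ → Ω → Noise d}
  [mΩ : MeasurableSpace Ω] {P : Measure Ω} [IsProbabilityMeasure P] {xstar : Profile n}
  {ρ c C D q ε : ℝ}

theorem le_mul_of_eq_ceil (hB : 0 < B) (hn₀ : n₀ = ⌈(B₂ : ℝ) / B⌉₊) : B₂ ≤ B * n₀ := by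
  have h := Nat.le_ceil ((B₂ : ℝ) / B)
  rw [← hn₀, div_le_iff₀ (by positivity), mul_comm] at h
  exact_mod_cast h

/-- With delays independent of the iterates, `x_K` is an `ε`-NE. -/
theorem IsAsyncRun.isEpsNE_of_indep [NeZero N] (hG : G.Regular M) (hdd : G.DiagDominant)
    (hμ : 0 < μ) (hstar : G.IsNash xstar) (hrun : IsAsyncRun G μ M I B₂ J P x τ ξ)
    (hind : DelaysIndep I P x τ) (hB : 0 < B) (hI : UpdatesWithin I B) (hB₂ : B₂ ≤ B * n₀)
    (hρ : ρ = G.aInf μ ^ (1 / ((n₀ : ℝ) + 1))) (hc : c = ρ ^ (1 / (B : ℝ))) (hq : c < q)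
    (hq1 : q < 1) (hD : D = 1 / Real.log ((q / c) ^ Real.exp 1)) (hD0 : 0 < D)
    (hα : IsInexactBR G μ I J (fun i k => G.aInf μ ^ updateCount I i k) P x τ ξ)
    (hC0 : 0 ≤ C) (hC : ∀ i, ∫ ω, ‖x 0 ω i - xstar i‖ ∂P ≤ C) (hε : 0 < ε) :
    IsEpsNE P xstar ε (x (majorIters ρ C D q B ε)) := fun i => by
  have h0 := StochGame.aInf_pos hdd hμ
  have hρ0 : 0 < ρ := hρ ▸ Real.rpow_pos_of_pos h0 _
  have hc0 : 0 < c := hc ▸ Real.rpow_pos_of_pos hρ0 _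
  have hη := eq_rate_pow h0 hB hρ hc
  have hc1 : c ≤ 1 := (hq.trans hq1).le
  refine le_of_mul_pow_le (C := C) (a := C) (b := 1) hρ0 hB hc hq hq1 hD hε (by positivity) hC0 zero_le_one
    (by rw [one_mul]) ?_
  rw [one_mul]
  exact hrun.integral_norm_sub_mul_le_of_indep hG hdd hμ hstar hind hc0 hc1 hB hI hB₂ hη hα
    (fun k i hi => ⟨by positivity, by rw [hη]; exact pow_updateCount_le hc0 hc1 hB hI hi⟩)
    hC hC0 _ i

/-- With arbitrary bounded delays, `x_K` is an `ε`-NE for a larger constant `C`. -/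
theorem IsAsyncRun.isEpsNE [NeZero N] (hG : G.Regular M) (hdd : G.DiagDominant)
    (hμ : 0 < μ) (hstar : G.IsNash xstar) (hrun : IsAsyncRun G μ M I B₂ J P x τ ξ)
    (hB : 0 < B) (hI : UpdatesWithin I B) (hB₂ : B₂ ≤ B * n₀)
    (hρ : ρ = G.aInf μ ^ (1 / ((n₀ : ℝ) + 1))) (hc : c = ρ ^ (1 / (B : ℝ))) (hq : c < q)
    (hq1 : q < 1) (hD : D = 1 / Real.log ((q / c) ^ Real.exp 1)) (hD0 : 0 < D)
    (hα : IsInexactBR G μ I J (fun i k => G.aInf μ ^ updateCount I i k) P x τ ξ)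
    (hC : ∑ j, Metric.diam (G.X j) + N * D ≤ C + D) (hε : 0 < ε) :
    IsEpsNE P xstar ε (x (majorIters ρ C D q B ε)) := fun i => by
  have h0 := StochGame.aInf_pos hdd hμ
  have hρ0 : 0 < ρ := hρ ▸ Real.rpow_pos_of_pos h0 _
  have hc0 : 0 < c := hc ▸ Real.rpow_pos_of_pos hρ0 _
  have hη := eq_rate_pow h0 hB hρ hc
  have hc1 : c ≤ 1 := (hq.trans hq1).le
  have hR : 0 ≤ ∑ j, Metric.diam (G.X j) := Finset.sum_nonneg fun j _ => Metric.diam_nonneg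
  have hN : (0 : ℝ) < N := Nat.cast_pos.2 (NeZero.pos N)
  have hND : 0 < N * D := by positivity
  exact le_of_mul_pow_le hρ0 hB hc hq hq1 hD hε (by linarith) hR hN.le hC
    (hrun.integral_norm_sub_mul_le hG hdd hμ hstar hc0 hc1 hB hI hB₂ hη hα
      (fun k i hi => ⟨by positivity, by rw [hη]; exact pow_updateCount_le hc0 hc1 hB hI hi⟩) _ i)

end EpsNash

end AsyncBR

/-! ### Assembly for the general and the cyclic scheme. -/

theorem mainTheorem11 {N : ℕ} [NeZero N] {n : Fin N → ℕ} {d : ℕ}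
    (G : AsyncBR.StochGame n d) (M : Fin N → ℝ) (hG : G.Regular M) (hdd : G.DiagDominant)
    (μ : ℝ) (hμ : 0 < μ) (xstar : AsyncBR.Profile n) (hstar : G.IsNash xstar)
    (η : ℝ) (hη : η = G.aInf μ) :
    (0 < η ∧ η < 1) ∧
    -- (a) general asynchronous updates
    (∀ (B₁ B₂ : ℕ) (I : ℕ → Finset (Fin N)), 0 < B₁ → AsyncBR.UpdatesWithin I B₁ →
      ∀ n₀ n' : ℕ, n₀ = ⌈(B₂ : ℝ) / B₁⌉₊ → n' = B₁ * (1 + n₀) →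
      ∀ ρ c : ℝ, ρ = (max (G.aInf μ) η) ^ (1 / ((n₀ : ℝ) + 1)) → c = ρ ^ (1 / (B₁ : ℝ)) →
      ∀ δ : ℝ, 0 < δ →
      ∀ D : ℝ, D = ((n' : ℝ) + 2 * (n' : ℝ) ^ 2 * δ⁻¹) / (Real.exp 1 * Real.log η⁻¹) →
      -- explicit bounds
      (∃ q : ℝ, c < q ∧ q < 1 ∧ D = 1 / Real.log ((q / c) ^ Real.exp 1) ∧
        ∀ C : ℝ, 0 ≤ C →
          (∀ i, ∀ ε : ℝ, 0 < ε → ∀ εh : ℝ,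
            εh = ε / (C + D) * η ^ (((B₁ : ℝ) - 1) / (B₁ * ((n₀ : ℝ) + 1))) →
            AsyncBR.ell₁ (G.Q μ M i) η ρ C D q B₁ ε ≤
              G.Q μ M i / (η ^ 4 * Real.log (1 / η ^ 2)) * (1 / εh) ^ (2 * (n' : ℝ) + δ) +
              ⌈Real.log (1 / εh) * ((2 * (n' : ℝ) + δ) / (2 * Real.log η⁻¹))⌉₊) ∧
          (∀ i, (fun ε : ℝ => AsyncBR.ell₁ (G.Q μ M i) η ρ C D q B₁ ε) =O[𝓝[>] 0]
            fun ε : ℝ => (1 / ε) ^ (2 * (n' : ℝ) + δ)) ∧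
          (B₁ = 1 →
            D = ((1 + (B₂ : ℝ)) + 2 * (1 + (B₂ : ℝ)) ^ 2 * δ⁻¹) /
              (Real.exp 1 * Real.log η⁻¹) ∧
            ∀ i, ∀ ε : ℝ, 0 < ε →
            AsyncBR.ell₁ (G.Q μ M i) η ρ C D q B₁ ε ≤
              G.Q μ M i / (η ^ 4 * Real.log (1 / η ^ 2)) *
                ((C + D) / ε) ^ (2 * (1 + (B₂ : ℝ)) + δ) +
              ⌈Real.log ((C + D) / ε) *
                ((2 * ((B₂ : ℝ) + 1) + δ) / (2 * Real.log η⁻¹))⌉₊) ∧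
          (B₁ = 1 → B₂ = 0 →
            D = (1 + 2 * δ⁻¹) / (Real.exp 1 * Real.log η⁻¹) ∧
            ∀ i, ∀ ε : ℝ, 0 < ε →
            AsyncBR.ell₁ (G.Q μ M i) η ρ C D q B₁ ε ≤
              G.Q μ M i / (η ^ 4 * Real.log (1 / η ^ 2)) * ((C + D) / ε) ^ (2 + δ) +
              ⌈Real.log ((C + D) / ε) * ((2 + δ) / (2 * Real.log η⁻¹))⌉₊) ∧
          -- the expression bounds the number of projected gradient steps
          (∀ i, ∀ ε : ℝ, 0 < ε →
            (AsyncBR.totalSteps I (AsyncBR.stepsAsync (G.Q μ M) η) i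
              (AsyncBR.majorIters ρ C D q B₁ ε) : ℝ) ≤
              AsyncBR.ell₁ (G.Q μ M i) η ρ C D q B₁ ε) ∧
          (∀ {Ω : Type*} [MeasurableSpace Ω] (P : Measure Ω) [IsProbabilityMeasure P]
            (x : ℕ → Ω → AsyncBR.Profile n) (τ : Fin N → Fin N → ℕ → Ω → ℕ)
            (ξ : Fin N → ℕ → ℕ → Ω → AsyncBR.Noise d),
            AsyncBR.IsAsyncRun G μ M I B₂ (AsyncBR.stepsAsync (G.Q μ M) η) P x τ ξ →
            AsyncBR.DelaysIndep I P x τ →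
            (∀ i, ∫ ω, ‖x 0 ω i - xstar i‖ ∂P ≤ C) →
            ∀ ε : ℝ, 0 < ε →
              AsyncBR.IsEpsNE P xstar ε (x (AsyncBR.majorIters ρ C D q B₁ ε)))) ∧
      -- order of the number of steps, for arbitrary bounded random delays
      (∃ A : ℝ, ∀ ε : ℝ, 0 < ε → ε ≤ 1 → ∃ K : ℕ,
        (∀ i, (AsyncBR.totalSteps I (AsyncBR.stepsAsync (G.Q μ M) η) i K : ℝ) ≤
          A * (1 / ε) ^ (2 * (n' : ℝ) + δ)) ∧
        ∀ {Ω : Type*} [MeasurableSpace Ω] (P : Measure Ω) [IsProbabilityMeasure P]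
          (x : ℕ → Ω → AsyncBR.Profile n) (τ : Fin N → Fin N → ℕ → Ω → ℕ)
          (ξ : Fin N → ℕ → ℕ → Ω → AsyncBR.Noise d),
          AsyncBR.IsAsyncRun G μ M I B₂ (AsyncBR.stepsAsync (G.Q μ M) η) P x τ ξ →
          AsyncBR.IsEpsNE P xstar ε (x K)) ∧
      -- every run is an inexact proximal best-response scheme with `α_(i,k) = η ^ β_(i,k)`
      (∀ {Ω : Type*} [MeasurableSpace Ω] (P : Measure Ω) [IsProbabilityMeasure P]
        (x : ℕ → Ω → AsyncBR.Profile n) (τ : Fin N → Fin N → ℕ → Ω → ℕ)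
        (ξ : Fin N → ℕ → ℕ → Ω → AsyncBR.Noise d),
        AsyncBR.IsAsyncRun G μ M I B₂ (AsyncBR.stepsAsync (G.Q μ M) η) P x τ ξ →
        AsyncBR.IsInexactBR G μ I (AsyncBR.stepsAsync (G.Q μ M) η)
          (fun i k => η ^ AsyncBR.updateCount I i k) P x τ ξ)) ∧
    -- (b) cyclic updates
    (∀ (B₂ : ℕ) (I : ℕ → Finset (Fin N)), AsyncBR.UpdatesCyclically I →
      ∀ n₀ : ℕ, n₀ = ⌈(B₂ : ℝ) / N⌉₊ →
      ∀ ρ c : ℝ, ρ = (max (G.aInf μ) η) ^ (1 / ((n₀ : ℝ) + 1)) → c = ρ ^ (1 / (N : ℝ)) →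
      ∀ δ : ℝ, 0 < δ →
      ∀ D : ℝ, D = (N : ℝ) * (1 + (n₀ : ℝ)) *
        ((1 + 2 * (1 + (n₀ : ℝ)) * δ⁻¹) / (Real.exp 1 * Real.log η⁻¹)) →
      (∃ q : ℝ, c < q ∧ q < 1 ∧ D = 1 / Real.log ((q / c) ^ Real.exp 1) ∧
        ∀ C : ℝ, 0 ≤ C →
          (∀ i, ∀ ε : ℝ, 0 < ε → ∀ εt : ℝ,
            εt = ε / (C + D) * η ^ (((N : ℝ) - 1) / (N * (1 + (n₀ : ℝ)))) →
            AsyncBR.ell₂ (G.Q μ M i) η ρ C D q N ε ≤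
              G.Q μ M i / (η ^ (2 + 2 / (N : ℝ)) * Real.log (1 / η ^ (2 / (N : ℝ)))) *
                (1 / εt) ^ (2 * ((n₀ : ℝ) + 1) + δ) +
              ⌈Real.log (1 / εt) *
                ((2 * ((n₀ : ℝ) + 1) + δ) / (2 * Real.log η⁻¹ / N))⌉₊) ∧
          (∀ i, (fun ε : ℝ => AsyncBR.ell₂ (G.Q μ M i) η ρ C D q N ε) =O[𝓝[>] 0]
            fun ε : ℝ => (1 / ε) ^ (2 * ((n₀ : ℝ) + 1) + δ)) ∧
          (B₂ = 0 →
            D = (N : ℝ) * (1 + 2 * δ⁻¹) / (Real.exp 1 * Real.log η⁻¹) ∧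
            ∀ i, ∀ ε : ℝ, 0 < ε → ∀ εt : ℝ,
            εt = ε / (C + D) * ρ ^ (((N : ℝ) - 1) / N) →
            AsyncBR.ell₂ (G.Q μ M i) η ρ C D q N ε ≤
              G.Q μ M i / (η ^ (2 + 2 / (N : ℝ)) * Real.log (1 / η ^ (2 / (N : ℝ)))) *
                (1 / εt) ^ (2 + δ) +
              ⌈Real.log (1 / εt) * ((2 + δ) * N / (2 * Real.log η⁻¹))⌉₊) ∧
          (∀ i, ∀ ε : ℝ, 0 < ε →
            (AsyncBR.totalSteps I (AsyncBR.stepsCyclic (G.Q μ M) η) i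
              (AsyncBR.majorIters ρ C D q N ε) : ℝ) ≤
              AsyncBR.ell₂ (G.Q μ M i) η ρ C D q N ε) ∧
          (∀ {Ω : Type*} [MeasurableSpace Ω] (P : Measure Ω) [IsProbabilityMeasure P]
            (x : ℕ → Ω → AsyncBR.Profile n) (τ : Fin N → Fin N → ℕ → Ω → ℕ)
            (ξ : Fin N → ℕ → ℕ → Ω → AsyncBR.Noise d),
            AsyncBR.IsAsyncRun G μ M I B₂ (AsyncBR.stepsCyclic (G.Q μ M) η) P x τ ξ →
            AsyncBR.DelaysIndep I P x τ →
            (∀ i, ∫ ω, ‖x 0 ω i - xstar i‖ ∂P ≤ C) →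
            ∀ ε : ℝ, 0 < ε →
              AsyncBR.IsEpsNE P xstar ε (x (AsyncBR.majorIters ρ C D q N ε)))) ∧
      (∃ A : ℝ, ∀ ε : ℝ, 0 < ε → ε ≤ 1 → ∃ K : ℕ,
        (∀ i, (AsyncBR.totalSteps I (AsyncBR.stepsCyclic (G.Q μ M) η) i K : ℝ) ≤
          A * (1 / ε) ^ (2 * ((n₀ : ℝ) + 1) + δ)) ∧
        ∀ {Ω : Type*} [MeasurableSpace Ω] (P : Measure Ω) [IsProbabilityMeasure P]
          (x : ℕ → Ω → AsyncBR.Profile n) (τ : Fin N → Fin N → ℕ → Ω → ℕ)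
          (ξ : Fin N → ℕ → ℕ → Ω → AsyncBR.Noise d),
          AsyncBR.IsAsyncRun G μ M I B₂ (AsyncBR.stepsCyclic (G.Q μ M) η) P x τ ξ →
          AsyncBR.IsEpsNE P xstar ε (x K)) ∧
      -- every run is an inexact proximal best-response scheme with `α_(i,k) = η ^ β_(i,k)`
      (∀ {Ω : Type*} [MeasurableSpace Ω] (P : Measure Ω) [IsProbabilityMeasure P]
        (x : ℕ → Ω → AsyncBR.Profile n) (τ : Fin N → Fin N → ℕ → Ω → ℕ)
        (ξ : Fin N → ℕ → ℕ → Ω → AsyncBR.Noise d),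
        AsyncBR.IsAsyncRun G μ M I B₂ (AsyncBR.stepsCyclic (G.Q μ M) η) P x τ ξ →
        AsyncBR.IsInexactBR G μ I (AsyncBR.stepsCyclic (G.Q μ M) η)
          (fun i k => η ^ AsyncBR.updateCount I i k) P x τ ξ)) := by
  subst hη
  have h0 := AsyncBR.StochGame.aInf_pos hdd hμ
  have h1 := AsyncBR.StochGame.aInf_lt_one hdd hμ
  have hQ : ∀ i, 0 ≤ G.Q μ M i := AsyncBR.StochGame.Q_nonneg μ
  have hR : 0 ≤ ∑ j, Metric.diam (G.X j) := Finset.sum_nonneg fun j _ => Metric.diam_nonneg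
  have hN : (0 : ℝ) < N := Nat.cast_pos.2 (NeZero.pos N)
  have hL : 0 < Real.log (G.aInf μ)⁻¹ := Real.log_pos ((one_lt_inv₀ h0).2 h1)
  refine ⟨⟨h0, h1⟩, ?_, ?_⟩
  · intro B₁ B₂ I hB hI n₀ n' hn₀ hn' ρ c hρ hc δ hδ D hD
    rw [max_self] at hρ
    have hB₂ := AsyncBR.le_mul_of_eq_ceil hB hn₀
    have hρ0 : 0 < ρ := hρ ▸ Real.rpow_pos_of_pos h0 _
    have hp : (0 : ℝ) < n' := by
      rw [hn']
      exact Nat.cast_pos.2 (Nat.mul_pos hB (by omega))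
    have hcη : c = G.aInf μ ^ (1 / (n' : ℝ)) := by
      rw [AsyncBR.rate_eq_rpow h0 hρ hc, hn']
      push_cast
      rfl
    -- The rate is fixed before `C` and ε are introduced, so it cannot depend on them.
    obtain ⟨hD0, q, hcq, hq1, hDq, hlq⟩ := AsyncBR.exists_rate h0 h1 hp hδ hcη hD
    refine ⟨⟨q, hcq, hq1, hDq, fun C hC => ⟨?_, ?_, ?_, ?_, ?_, ?_⟩⟩, ?_, ?_⟩
    · rintro i ε hε _ rfl
      rw [AsyncBR.ell₁_eq h0 h1 hp hδ hlq, AsyncBR.epsHat_eq_rpow h0 hρ]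
    · intro i
      obtain ⟨A, -, hA⟩ := AsyncBR.exists_ell₁_bound (C := C) (D := D) (B := B₁) (hQ i) h0 h1 hρ0
        (by positivity) hp hδ hlq
      exact AsyncBR.isBigO_of_bound_unit
        (fun ε hε => AsyncBR.ell₁_nonneg (hQ i) h0 h1 hρ0 (by positivity) hε) hA
    · rintro rfl
      have hnB : n₀ = B₂ := by simpa using hn₀
      have hn : (n' : ℝ) = 1 + B₂ := by
        rw [hn', hnB]
        push_cast
        ring
      refine ⟨by rw [hD, hn], fun i ε hε => le_of_eq ?_⟩
      rw [AsyncBR.ell₁_eq h0 h1 hp hδ hlq, AsyncBR.one_div_epsHat, hn]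
      simp [add_comm (B₂ : ℝ)]
    · rintro rfl rfl
      have hn₀' : n₀ = 0 := by simpa using hn₀
      have hn : (n' : ℝ) = 1 := by
        rw [hn', hn₀']
        push_cast
        ring
      refine ⟨by rw [hD, hn]; norm_num, fun i ε hε => le_of_eq ?_⟩
      rw [AsyncBR.ell₁_eq h0 h1 hp hδ hlq, AsyncBR.one_div_epsHat, hn]
      simp
    · exact fun i ε hε =>
        AsyncBR.totalSteps_stepsAsync_le hQ h0 h1 hρ0 (by positivity) hε i
    · intro Ω _ P _ x τ ξ hrun hind hx ε hε
      exact hrun.isEpsNE_of_indep hG hdd hμ hstar hind hB hI hB₂ hρ hc hcq hq1 hDq hD0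
        (hrun.isInexactBR hG hdd hμ fun k i _ => AsyncBR.le_stepsAsync h0 h1.le i k) hC hx hε
    -- This `C` makes C + D dominate the constant of the pathwise bound, so the same iteration
    -- formula serves arbitrary delays; the sum of the players' constants gives one `A` for all.
    · set C : ℝ := ∑ j, Metric.diam (G.X j) + N * D with hCdef
      have hCD : 0 < C + D := by positivity
      choose A hA0 hA using fun i => AsyncBR.exists_ell₁_bound (C := C) (D := D) (B := B₁) (hQ i)
        h0 h1 hρ0 hCD hp hδ hlq
      refine ⟨∑ i, A i, fun ε hε hε1 => ⟨AsyncBR.majorIters ρ C D q B₁ ε, fun i => ?_, ?_⟩⟩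
      · refine (AsyncBR.totalSteps_stepsAsync_le hQ h0 h1 hρ0 hCD hε i).trans
          ((hA i ε hε hε1).trans ?_)
        gcongr
        exact Finset.single_le_sum (fun j _ => hA0 j) (Finset.mem_univ i)
      · intro Ω _ P _ x τ ξ hrun
        exact hrun.isEpsNE hG hdd hμ hstar hB hI hB₂ hρ hc hcq hq1 hDq hD0
          (hrun.isInexactBR hG hdd hμ fun k i _ => AsyncBR.le_stepsAsync h0 h1.le i k)
          (by linarith) hε
    · intro Ω _ P _ x τ ξ hrun
      exact hrun.isInexactBR hG hdd hμ fun k i _ => AsyncBR.le_stepsAsync h0 h1.le i k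
  · intro B₂ I hcyc n₀ hn₀ ρ c hρ hc δ hδ D hD
    rw [max_self] at hρ
    have hB : 0 < N := NeZero.pos N
    have hI := hcyc.updatesWithin
    have hB₂ := AsyncBR.le_mul_of_eq_ceil hB hn₀
    have hρ0 : 0 < ρ := hρ ▸ Real.rpow_pos_of_pos h0 _
    have hp : (0 : ℝ) < (n₀ : ℝ) + 1 := by positivity
    have hcη : c = G.aInf μ ^ (1 / ((N : ℝ) * ((n₀ : ℝ) + 1))) := by
      rw [AsyncBR.rate_eq_rpow h0 hρ hc, add_comm (1 : ℝ)]
    -- The prescribed `D` is the general formula with p = N(n₀+1) and N δ in place of δ.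
    have hD' : D = ((N : ℝ) * ((n₀ : ℝ) + 1) + 2 * ((N : ℝ) * ((n₀ : ℝ) + 1)) ^ 2 *
        ((N : ℝ) * δ)⁻¹) / (Real.exp 1 * Real.log (G.aInf μ)⁻¹) := by
      rw [hD, ← mul_div_assoc]
      congr 1
      field_simp
      ring
    obtain ⟨hD0, q, hcq, hq1, hDq, hlq⟩ :=
      AsyncBR.exists_rate h0 h1 (mul_pos hN hp) (mul_pos hN hδ) hcη hD'
    refine ⟨⟨q, hcq, hq1, hDq, fun C hC => ⟨?_, ?_, ?_, ?_, ?_⟩⟩, ?_, ?_⟩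
    · rintro i ε hε _ rfl
      rw [AsyncBR.ell₂_eq h0 h1 hp hδ hlq, AsyncBR.epsHat_eq_rpow h0 hρ, add_comm (1 : ℝ)]
    · intro i
      obtain ⟨A, -, hA⟩ := AsyncBR.exists_ell₂_bound (C := C) (D := D) (hQ i) h0 h1 hρ0
        (by positivity) hp hδ hlq
      exact AsyncBR.isBigO_of_bound_unit
        (fun ε hε => AsyncBR.ell₂_nonneg (hQ i) h0 h1 hρ0 (by positivity) hε) hA
    · rintro rfl
      have hn₀' : (n₀ : ℝ) = 0 := by
        rw [hn₀]
        simp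
      refine ⟨by rw [hD, hn₀']; ring, ?_⟩
      rintro i ε hε _ rfl
      refine le_of_eq ?_
      rw [AsyncBR.ell₂_eq h0 h1 hp hδ hlq, hn₀', ← AsyncBR.epsHat]
      simp only [zero_add, mul_one, div_div_eq_mul_div]
    · exact fun i ε hε =>
        AsyncBR.totalSteps_stepsCyclic_le hQ h0 h1 hρ0 (by positivity) hε i
    · intro Ω _ P _ x τ ξ hrun hind hx ε hε
      exact hrun.isEpsNE_of_indep hG hdd hμ hstar hind hB hI hB₂ hρ hc hcq hq1 hDq hD0
        (hrun.isInexactBR hG hdd hμ fun k i _ => AsyncBR.le_stepsCyclic hcyc h0 h1.le i k) hC hx hε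
    · set C : ℝ := ∑ j, Metric.diam (G.X j) + N * D with hCdef
      have hCD : 0 < C + D := by positivity
      choose A hA0 hA using fun i => AsyncBR.exists_ell₂_bound (C := C) (D := D) (hQ i)
        h0 h1 hρ0 hCD hp hδ hlq
      refine ⟨∑ i, A i, fun ε hε hε1 => ⟨AsyncBR.majorIters ρ C D q N ε, fun i => ?_, ?_⟩⟩
      · refine (AsyncBR.totalSteps_stepsCyclic_le hQ h0 h1 hρ0 hCD hε i).trans
          ((hA i ε hε hε1).trans ?_)
        gcongr
        exact Finset.single_le_sum (fun j _ => hA0 j) (Finset.mem_univ i)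
      · intro Ω _ P _ x τ ξ hrun
        exact hrun.isEpsNE hG hdd hμ hstar hB hI hB₂ hρ hc hcq hq1 hDq hD0
          (hrun.isInexactBR hG hdd hμ fun k i _ => AsyncBR.le_stepsCyclic hcyc h0 h1.le i k)
          (by linarith) hε
    · intro Ω _ P _ x τ ξ hrun
      exact hrun.isInexactBR hG hdd hμ fun k i _ => AsyncBR.le_stepsCyclic hcyc h0 h1.le i k
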